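/- Let $k$ be a field of characteristic $0$, $\mathfrak g$ a finite-dimensional Lie algebra over $k$ with basis $\hat x_1,\dots,\hat x_n$, and $U(\mathfrak g)$ its universal enveloping Hopf algebra with antipode $S$. Let $\hat S(\mathfrak g^*)=k[[\partial^1,\dots,\partial^n]]$, where $\partial^1,\dots,\partial^n$ is the dual basis, and let $\hat S(\mathfrak g^*)\hat\otimes\hat S(\mathfrak g^*)$ be the algebra of formal power series in the $2n$ variables $\partial^i\otimes 1$, $1\otimes\partial^i$. Let $\phi:\mathfrak g\to\mathrm{Der}_k(\hat S(\mathfrak g^*))$ be a Lie algebra homomorphism such that $\phi(-\hat x_i)(\partial^j)$ has constant term $\delta_i^j$ for all $i,j$; denote also by $\phi$ its extension to an algebra homomorphism $U(\mathfrak g)\to\mathrm{End}_k(\hat S(\mathfrak g^*))$. The $(\mathfrak g,\phi)$-twisted Weyl algebra $A_{\mathfrak g,\phi}=U(\mathfrak g)\sharp\hat S(\mathfrak g^*)$ is the space $U(\mathfrak g)\otimes\hat S(\mathfrak g^*)$ with the product $$(\hat u\otimes P)(\hat v\otimes Q)=\sum \hat u\,\hat v_{(1)}\otimes\phi(S(\hat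 v_{(2)}))(P)\,Q .$$ It acts on $U(\mathfrak g)$ by $a\blacktriangleright\hat u=(\mathrm{id}\otimes\epsilon)(a\cdot(\hat u\otimes 1))$, where $\epsilon(P)$ is the constant term of $P$; write $P\blacktriangleright\hat u$ for $(1\otimes P)\blacktriangleright\hat u$. Put $\langle\hat u,P\rangle_\phi=\epsilon\big(\phi(S(\hat u))(P)\big)$. Then: 1. $A_{\mathfrak g,\phi}$ is an associative unital algebra. For every $P\in\hat S(\mathfrak g^*)$ there is exactly one $\Delta_\phi(P)=\sum P_{(1)}\otimes P_{(2)}$ in $\hat S(\mathfrak g^*)\hat\otimes\hat S(\mathfrak g^*)$ satisfying the deformed Leibniz rule $P\blacktriangleright(\hat u\hat v)=\sum(P_{(1)}\blacktriangleright\hat u)(P_{(2)}\blacktriangleright\hat v)$ for all $\hat u,\hat v\in U(\mathfrak g)$. With this $\phi$-deformed coproduct and counit $\epsilon$, $\hat S(\mathfrak g^*)$ is a topological Hopf algebra, $\langle\,,\rangle_\phi$ is a (continuous) Hopf pairing between $U(\mathfrak g)$ and $\hat S(\mathfrak g^*)$, and $P\cdot\hat u=\sum\langle\hat u_{(2)},P\rangle_\phi\,\hat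 u_{(1)}$ is a Hopf action of $\hat S(\mathfrak g^*)$ on $U(\mathfrak g)$. The corresponding Heisenberg double, that is $U(\mathfrak g)\otimes\hat S(\mathfrak g^*)$ with the product $$(\hat u\otimes P)(\hat v\otimes Q)=\sum\hat u\,(P_{(1)}\cdot\hat v)\otimes P_{(2)}Q=\sum\langle\hat v_{(2)},P_{(1)}\rangle_\phi\;\hat u\,\hat v_{(1)}\otimes P_{(2)}Q ,$$ is a well-defined associative unital algebra. 2. $A_{\mathfrak g,\phi}$ is isomorphic to this Heisenberg double, by an algebra isomorphism which is the identity on the subalgebras $U(\mathfrak g)\otimes 1$ and $1\otimes\hat S(\mathfrak g^*)$. Both products extend, by the same formulas, to associative unital products on the completion $U(\mathfrak g)\hat\otimes\hat S(\mathfrak g^*)$ of formal series $\sum_\alpha a_\alpha\partial^\alpha$ with $a_\alpha\in U(\mathfrak g)$, and the isomorphism extends to the completed algebras. 3. The action $\blacktriangleright$ also presents $A_{\mathfrak g,\phi}$ as a smash product for the action of $\hat S(\mathfrak g^*)$ on $U(\mathfrak g)$: $(\hat u\otimes P)(\hat v\otimes Q)=\sum\hat u(P_{(1)}\blacktriangleright\hat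 v)\otimes P_{(2)}Q$ in $A_{\mathfrak g,\phi}$. This action satisfies, and is determined by, the formula $$P\blacktriangleright\hat u=\sum\langle\hat u_{(2)},P\rangle_\phi\,\hat u_{(1)}\qquad\text{for all }\hat u\in U(\mathfrak g),\ P\in\hat S(\mathfrak g^*).$$ -/

import Mathlib

open scoped TensorProduct

section
attribute [local instance 100] LieRing.ofAssociativeRing LieAlgebra.ofAssociativeAlgebra

namespace HD.UEnv

variable (k : Type*) (g : Type*) [Field k] [LieRing g] [LieAlgebra k g]

local notation "U" => UniversalEnvelopingAlgebra k g
local notation "ι" => UniversalEnvelopingAlgebra.ι k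

theorem inc_lie (x y : g) : ι ⁅x, y⁆ = (ι x * ι y - ι y * ι x : U) := by
  rw [LieHom.map_lie, LieRing.of_associative_ring_bracket]

/-- The coproduct of `U(g)`: the algebra map with `x ↦ x ⊗ 1 + 1 ⊗ x` on `g`. -/
noncomputable def comulHom : U →ₐ[k] U ⊗[k] U :=
  UniversalEnvelopingAlgebra.lift k
    { toFun := fun x => ι x ⊗ₜ[k] 1 + 1 ⊗ₜ[k] ι x
      map_add' := fun x y => by
        simp only [map_add, TensorProduct.add_tmul, TensorProduct.tmul_add]; abel
      map_smul' := fun c x => by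
        simp [TensorProduct.smul_tmul', TensorProduct.tmul_smul]
      map_lie' := fun {x y} => by
        simp only [LieRing.of_associative_ring_bracket, inc_lie, mul_add, add_mul,
          Algebra.TensorProduct.tmul_mul_tmul, one_mul, mul_one, TensorProduct.sub_tmul,
          TensorProduct.tmul_sub]
        abel }

/-- The counit of `U(g)`: the algebra map with `x ↦ 0` on `g`. -/
noncomputable def counitHom : U →ₐ[k] k :=
  UniversalEnvelopingAlgebra.lift k (0 : g →ₗ⁅k⁆ k)

/-- The antipode of `U(g)` as an algebra map to the opposite algebra: `x ↦ -x` on `g`. -/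
noncomputable def antipodeHom : U →ₐ[k] (U)ᵐᵒᵖ :=
  UniversalEnvelopingAlgebra.lift k
    { toFun := fun x => MulOpposite.op (-ι x)
      map_add' := fun x y => by
        simp only [map_add, neg_add, MulOpposite.op_add]
      map_smul' := fun c x => by simp
      map_lie' := fun {x y} => by
        simp only [LieRing.of_associative_ring_bracket, inc_lie, ← MulOpposite.op_mul,
          ← MulOpposite.op_sub]
        congr 1
        noncomm_ring }

@[simp] theorem comulHom_inc (x : g) :
    comulHom k g (ι x) = ι x ⊗ₜ[k] 1 + 1 ⊗ₜ[k] ι x :=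
  UniversalEnvelopingAlgebra.lift_ι_apply k _ x

@[simp] theorem counitHom_inc (x : g) : counitHom k g (ι x) = 0 :=
  UniversalEnvelopingAlgebra.lift_ι_apply k _ x

@[simp] theorem antipodeHom_inc (x : g) :
    antipodeHom k g (ι x) = MulOpposite.op (-ι x) :=
  UniversalEnvelopingAlgebra.lift_ι_apply k _ x

variable {k g} in
theorem hom_ext' {B : Type*} [Ring B] [Algebra k B] {f₁ f₂ : U →ₐ[k] B}
    (h : ∀ x : g, f₁ (ι x) = f₂ (ι x)) : f₁ = f₂ :=
  UniversalEnvelopingAlgebra.hom_ext k (LieHom.ext h)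

variable {k g} in
theorem mem_of_gens (s : Subalgebra k U) (h : ∀ x : g, ι x ∈ s) (u : U) : u ∈ s := by
  let f : g →ₗ⁅k⁆ s :=
    { toFun := fun x => ⟨ι x, h x⟩
      map_add' := fun x y => by ext; simp
      map_smul' := fun c x => by ext; simp
      map_lie' := fun {x y} => by
        apply Subtype.ext
        simp only [LieRing.of_associative_ring_bracket, inc_lie]; rfl }
  have e : s.val.comp (UniversalEnvelopingAlgebra.lift k f) = AlgHom.id k U := by
    apply hom_ext'
    intro x
    rw [AlgHom.comp_apply, UniversalEnvelopingAlgebra.lift_ι_apply]; rfl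
  have := DFunLike.congr_fun e u
  rw [AlgHom.id_apply] at this
  rw [← this]
  exact (UniversalEnvelopingAlgebra.lift k f u).2

noncomputable instance : Bialgebra k U :=
  Bialgebra.ofAlgHom (comulHom k g) (counitHom k g)
    (by
      apply hom_ext'; intro x
      simp [-UniversalEnvelopingAlgebra.ι_apply, TensorProduct.add_tmul, TensorProduct.tmul_add,
        Algebra.TensorProduct.one_def, add_assoc])
    (by apply hom_ext'; intro x; simp [-UniversalEnvelopingAlgebra.ι_apply])
    (by apply hom_ext'; intro x; simp [-UniversalEnvelopingAlgebra.ι_apply])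

noncomputable def antipodeLin : U →ₗ[k] U :=
  (MulOpposite.opLinearEquiv k).symm.toLinearMap ∘ₗ (antipodeHom k g).toLinearMap

theorem antipodeLin_one : antipodeLin k g 1 = 1 := by simp [antipodeLin]
theorem antipodeLin_mul (u v : U) :
    antipodeLin k g (u * v) = antipodeLin k g v * antipodeLin k g u := by simp [antipodeLin]
theorem antipodeLin_inc (x : g) : antipodeLin k g (ι x) = - ι x := by
  simp [-UniversalEnvelopingAlgebra.ι_apply, antipodeLin]

theorem comul_inc (x : g) :
    (Coalgebra.comul (ι x) : U ⊗[k] U) = ι x ⊗ₜ[k] 1 + 1 ⊗ₜ[k] ι x :=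
  comulHom_inc k g x

theorem counit_inc (x : g) : (Coalgebra.counit (ι x : U) : k) = 0 :=
  counitHom_inc k g x

theorem antipode_left (u : U) :
    LinearMap.mul' k U ((antipodeLin k g).rTensor U (Coalgebra.comul u)) =
      algebraMap k U (Coalgebra.counit u) := by
  have key : ∀ (t : U ⊗[k] U) (v : U),
      LinearMap.mul' k U ((antipodeLin k g).rTensor U (t * Coalgebra.comul v)) = 
      LinearMap.mul' k U (TensorProduct.map LinearMap.id (LinearMap.mulLeft k 
        (LinearMap.mul' k U ((antipodeLin k g).rTensor U t))) ((antipodeLin k g).rTensor U (Coalgebra.comul v))) := by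
    intro t v
    generalize (Coalgebra.comul v : U ⊗[k] U) = w
    induction w with
    | zero => simp
    | add a b ha hb => simp only [mul_add, map_add, ha, hb]
    | tmul c d =>
      induction t with
      | zero => simp
      | add a b ha hb =>
        simp only [add_mul, map_add, ha, hb]
        simp [add_mul, mul_add]
      | tmul a b =>
        simp [antipodeLin_mul, mul_assoc]
  let s : Subalgebra k U :=
    { carrier := {u | LinearMap.mul' k U ((antipodeLin k g).rTensor U (Coalgebra.comul u)) =
        algebraMap k U (Coalgebra.counit u)}
      mul_mem' := fun {a b} ha hb => by
        simp only [Set.mem_ofPred_eq] at ha hb ⊢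
        rw [Bialgebra.comul_mul, key, ha, Bialgebra.counit_mul, map_mul, ← hb]
        generalize (antipodeLin k g).rTensor U (Coalgebra.comul b) = w
        induction w with
        | zero => simp
        | add a b ha hb => simp only [map_add, ha, hb, mul_add]
        | tmul c d =>
          simp only [TensorProduct.map_tmul, LinearMap.id_apply, LinearMap.mulLeft_apply,
            LinearMap.mul'_apply]
          rw [← mul_assoc, ← mul_assoc, Algebra.commutes]
      add_mem' := fun {a b} ha hb => by
        simp only [Set.mem_ofPred_eq] at ha hb ⊢
        simp only [map_add, ha, hb]
      algebraMap_mem' := fun r => by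
        simp [Algebra.algebraMap_eq_smul_one, antipodeLin_one, Algebra.TensorProduct.one_def] }
  exact mem_of_gens s (fun x => by
    change _ = _
    simp [-UniversalEnvelopingAlgebra.ι_apply, comul_inc, counit_inc, antipodeLin_inc, antipodeLin_one]) u

theorem antipode_right (u : U) :
    LinearMap.mul' k U ((antipodeLin k g).lTensor U (Coalgebra.comul u)) =
      algebraMap k U (Coalgebra.counit u) := by
  have key : ∀ (t : U ⊗[k] U) (v : U),
      LinearMap.mul' k U ((antipodeLin k g).lTensor U (Coalgebra.comul v * t)) = 
      LinearMap.mul' k U (TensorProduct.map (LinearMap.mulRight k 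
        (LinearMap.mul' k U ((antipodeLin k g).lTensor U t))) LinearMap.id ((antipodeLin k g).lTensor U (Coalgebra.comul v))) := by
    intro t v
    generalize (Coalgebra.comul v : U ⊗[k] U) = w
    induction w with
    | zero => simp
    | add a b ha hb => simp only [add_mul, map_add, ha, hb]
    | tmul c d =>
      induction t with
      | zero => simp
      | add a b ha hb =>
        simp only [mul_add, map_add, ha, hb]
        simp [add_mul, mul_add]
      | tmul a b =>
        simp [antipodeLin_mul, mul_assoc]
  let s : Subalgebra k U :=
    { carrier := {u | LinearMap.mul' k U ((antipodeLin k g).lTensor U (Coalgebra.comul u)) =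
        algebraMap k U (Coalgebra.counit u)}
      mul_mem' := fun {a b} ha hb => by
        simp only [Set.mem_ofPred_eq] at ha hb ⊢
        rw [Bialgebra.comul_mul, key, hb, Bialgebra.counit_mul, map_mul, ← ha]
        generalize (antipodeLin k g).lTensor U (Coalgebra.comul a) = w
        induction w with
        | zero => simp
        | add a b ha hb => simp only [map_add, ha, hb, add_mul]
        | tmul c d =>
          simp only [TensorProduct.map_tmul, LinearMap.id_apply, LinearMap.mulRight_apply,
            LinearMap.mul'_apply]
          rw [mul_assoc, mul_assoc, Algebra.commutes]
      add_mem' := fun {a b} ha hb => by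
        simp only [Set.mem_ofPred_eq] at ha hb ⊢
        simp only [map_add, ha, hb]
      algebraMap_mem' := fun r => by
        simp [Algebra.algebraMap_eq_smul_one, antipodeLin_one, Algebra.TensorProduct.one_def] }
  exact mem_of_gens s (fun x => by
    change _ = _
    simp [-UniversalEnvelopingAlgebra.ι_apply, comul_inc, counit_inc, antipodeLin_inc, antipodeLin_one]) u

noncomputable instance : HopfAlgebra k U where
  antipode := antipodeLin k g
  mul_antipode_rTensor_comul := LinearMap.ext (antipode_left k g)
  mul_antipode_lTensor_comul := LinearMap.ext (antipode_right k g)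

end HD.UEnv
end

section
attribute [local instance 100] LieRing.ofAssociativeRing LieAlgebra.ofAssociativeAlgebra

namespace HD

/-- The completed symmetric algebra `Ŝ(g*)`: formal power series in `∂^1, …, ∂^n`. -/
abbrev Shat (k : Type*) [Field k] (n : ℕ) := MvPowerSeries (Fin n) k

/-- The completed tensor square `Ŝ(g*) ⊗̂ Ŝ(g*)`: formal power series in the `2n` variables
`∂^i ⊗ 1` (indices `inl i`) and `1 ⊗ ∂^i` (indices `inr i`). -/
abbrev Shat2 (k : Type*) [Field k] (n : ℕ) := MvPowerSeries (Fin n ⊕ Fin n) k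

/-- Abbreviation for the universal enveloping algebra. -/
abbrev Env (k : Type*) (g : Type*) [Field k] [LieRing g] [LieAlgebra k g] :=
  UniversalEnvelopingAlgebra k g

variable {k : Type*} {g : Type*} [Field k] [LieRing g] [LieAlgebra k g] {n : ℕ}

/-- The monomial `∂^α`. -/
noncomputable def dmon (k : Type*) [Field k] {n : ℕ} (α : Fin n →₀ ℕ) : Shat k n :=
  MvPowerSeries.monomial α 1

/-- Evaluation at `1 ∈ S(g)` of a constant coefficient differential operator of infinite order:
all derivatives kill `1`, so this is the constant term. -/
noncomputable def vac (k : Type*) [Field k] (n : ℕ) : Shat k n →ₗ[k] k :=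
  MvPowerSeries.coeff 0

/-- The coefficient of `∂^α ⊗ ∂^β` in an element of `Ŝ(g*) ⊗̂ Ŝ(g*)`. -/
noncomputable def coeff2 (α β : Fin n →₀ ℕ) : Shat2 k n →ₗ[k] k :=
  MvPowerSeries.coeff (Finsupp.sumElim α β)

/-- The element `T_α` of `Ŝ(g*)` in the expansion `T = ∑_α ∂^α ⊗ T_α`. -/
noncomputable def slice (α : Fin n →₀ ℕ) : Shat2 k n →ₗ[k] Shat k n :=
  LinearMap.pi fun β => coeff2 α β

/-- The extension of a Lie algebra map `φ : g → Der(Ŝ(g*))` to an algebra map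
`U(g) → End(Ŝ(g*))`. -/
noncomputable def phiEnd (φ : g →ₗ⁅k⁆ Derivation k (Shat k n) (Shat k n)) :
    Env k g →ₐ[k] Module.End k (Shat k n) :=
  UniversalEnvelopingAlgebra.lift k
    { toFun := fun x => (φ x : Shat k n →ₗ[k] Shat k n)
      map_add' := fun x y => by simp
      map_smul' := fun c x => by simp
      map_lie' := fun {x y} => by
        rw [LieHom.map_lie, Derivation.commutator_coe_linear_map] }

theorem phiEnd_inc (φ : g →ₗ⁅k⁆ Derivation k (Shat k n) (Shat k n)) (x : g) (P : Shat k n) :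
    phiEnd φ (UniversalEnvelopingAlgebra.ι k x) P = φ x P := by
  rw [phiEnd, UniversalEnvelopingAlgebra.lift_ι_apply]; rfl

/-- The pairing `⟨u, P⟩_φ = φ(S(u))(P)(1)`, where `S` is the antipode of `U(g)`. -/
noncomputable def pairing (φ : g →ₗ⁅k⁆ Derivation k (Shat k n) (Shat k n)) :
    Env k g →ₗ[k] Shat k n →ₗ[k] k :=
  (vac k n).compRight k ∘ₗ (phiEnd φ).toLinearMap ∘ₗ HopfAlgebra.antipode k

/-! ### Products on `U(g) ⊗ Ŝ(g*)` -/

/-- The bilinear product on `U(g) ⊗ Ŝ(g*)` determined by an exchange rule `τ(P, v)` for the product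
`(1 ⊗ P)(v ⊗ 1)`: namely `(u ⊗ P)(v ⊗ Q) = (u ⊗ 1) τ(P, v) (1 ⊗ Q)`, where on the right `u` and `Q`
multiply the respective tensor factors (from the left and from the right). -/
noncomputable def exchangeMul (τ : Shat k n →ₗ[k] Env k g →ₗ[k] Env k g ⊗[k] Shat k n) :
    (Env k g ⊗[k] Shat k n) →ₗ[k] (Env k g ⊗[k] Shat k n) →ₗ[k] (Env k g ⊗[k] Shat k n) :=
  TensorProduct.lift <| LinearMap.mk₂ k
    (fun u P => TensorProduct.lift <| LinearMap.mk₂ k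
      (fun v Q => (u ⊗ₜ[k] 1) * τ P v * (1 ⊗ₜ[k] Q))
      (fun v v' Q => by simp [add_mul, mul_add])
      (fun c v Q => by
        rw [map_smul]
        exact (congrArg (· * _) (mul_smul_comm c _ _)).trans (smul_mul_assoc c _ _))
      (fun v Q Q' => by simp [TensorProduct.tmul_add, mul_add])
      (fun c v Q => by
        rw [TensorProduct.tmul_smul]
        exact mul_smul_comm c _ _))
    (fun u u' P => TensorProduct.ext' fun v Q => by simp [TensorProduct.add_tmul, add_mul])
    (fun c u P => TensorProduct.ext' fun v Q => by
      simp only [TensorProduct.lift.tmul, LinearMap.mk₂_apply, LinearMap.smul_apply,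
        ← TensorProduct.smul_tmul']
      exact (congrArg (· * _) (smul_mul_assoc c _ _)).trans (smul_mul_assoc c _ _))
    (fun u P P' => TensorProduct.ext' fun v Q => by simp [add_mul, mul_add])
    (fun c u P => TensorProduct.ext' fun v Q => by
      simp only [TensorProduct.lift.tmul, LinearMap.mk₂_apply, LinearMap.smul_apply, map_smul]
      exact (congrArg (· * _) (mul_smul_comm c _ _)).trans (smul_mul_assoc c _ _))

theorem exchangeMul_tmul (τ : Shat k n →ₗ[k] Env k g →ₗ[k] Env k g ⊗[k] Shat k n)
    (u v : Env k g) (P Q : Shat k n) :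
    exchangeMul τ (u ⊗ₜ P) (v ⊗ₜ Q) = (u ⊗ₜ[k] 1) * τ P v * (1 ⊗ₜ[k] Q) := rfl

/-- The product `m` is associative with unit `e`. -/
def IsUnitalAssociative {A : Type*} (m : A → A → A) (e : A) : Prop :=
  (∀ a b c, m (m a b) c = m a (m b c)) ∧ (∀ a, m e a = a) ∧ ∀ a, m a e = a

/-- The completed tensor product `U(g) ⊗̂ Ŝ(g*)`: formal series `∑_α a_α ∂^α` with arbitrary
coefficients `a_α` in `U(g)`, represented by `α ↦ a_α`. -/
abbrev Completed (k : Type*) (g : Type*) [Field k] [LieRing g] [LieAlgebra k g] (n : ℕ) :=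
  (Fin n →₀ ℕ) → Env k g

/-- The canonical map `U(g) ⊗ Ŝ(g*) → U(g) ⊗̂ Ŝ(g*)`, `u ⊗ P ↦ ∑_α (P_α u) ∂^α`. -/
noncomputable def toCompleted : Env k g ⊗[k] Shat k n →ₗ[k] Completed k g n :=
  LinearMap.pi fun γ => (TensorProduct.rid k (Env k g)).toLinearMap ∘ₗ
    (MvPowerSeries.coeff γ : Shat k n →ₗ[k] k).lTensor (Env k g)

/-- The product of formal series `(∑_α a_α ∂^α)(∑_β b_β ∂^β) = ∑_{α,β} a_α τ(∂^α, b_β) ∂^β` on the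
completed tensor product determined by an exchange rule `τ`, written out on coefficients. The sums
are finite for the exchange rules considered below, for which `τ(∂^α, v)` has no terms `w ⊗ ∂^γ`
with `|γ| < |α| - d`, for some `d` depending on `v`. -/
noncomputable def completedMul (τ : Shat k n →ₗ[k] Env k g →ₗ[k] Env k g ⊗[k] Shat k n)
    (a b : Completed k g n) : Completed k g n := fun γ =>
  ∑ᶠ p : (Fin n →₀ ℕ) × (Fin n →₀ ℕ),
    a p.1 * toCompleted (τ (dmon k p.1) (b p.2) * (1 ⊗ₜ[k] dmon k p.2)) γ

/-! ### The twisted Weyl algebra and the deformed derivatives -/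

/-- The exchange rule `P · v = ∑ v₍₁₎ ⊗ φ(S(v₍₂₎))(P)`, so that
`[∂^j, x_i] = φ(-x_i)(∂^j)` in the twisted Weyl algebra. -/
noncomputable def weylExchange (φ : g →ₗ⁅k⁆ Derivation k (Shat k n) (Shat k n)) :
    Shat k n →ₗ[k] Env k g →ₗ[k] Env k g ⊗[k] Shat k n :=
  LinearMap.mk₂ k
    (fun P v => (LinearMap.applyₗ P ∘ₗ (phiEnd φ).toLinearMap ∘ₗ HopfAlgebra.antipode k).lTensor
      (Env k g) (Coalgebra.comul v))
    (fun P P' v => by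
      rw [map_add, LinearMap.add_comp, LinearMap.lTensor_add, LinearMap.add_apply])
    (fun c P v => by
      rw [map_smul, LinearMap.smul_comp, LinearMap.lTensor_smul, LinearMap.smul_apply])
    (fun P v v' => by simp)
    (fun c P v => by simp)

/-- The product of the `(g, φ)`-twisted Weyl algebra `A_{g,φ} = U(g) ♯ Ŝ(g*)`, the smash product
for the Hopf action `φ` of `U(g)` on `Ŝ(g*)`:
`(u ⊗ P)(v ⊗ Q) = ∑ u v₍₁₎ ⊗ φ(S(v₍₂₎))(P) Q`. -/
noncomputable def weylMul (φ : g →ₗ⁅k⁆ Derivation k (Shat k n) (Shat k n)) :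
    (Env k g ⊗[k] Shat k n) →ₗ[k] (Env k g ⊗[k] Shat k n) →ₗ[k] (Env k g ⊗[k] Shat k n) :=
  exchangeMul (weylExchange φ)

/-- The projection `U(g) ⊗ Ŝ(g*) → U(g)` evaluating the second tensor factor, as a differential
operator, at `1`. -/
noncomputable def fockProj : Env k g ⊗[k] Shat k n →ₗ[k] Env k g :=
  (TensorProduct.rid k (Env k g)).toLinearMap ∘ₗ (vac k n).lTensor (Env k g)

/-- The action of the twisted Weyl algebra on the deformed Fock space `U(g)`: multiply inside
`A_{g,φ}`, then project to `U(g)`. -/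
noncomputable def fockAct (φ : g →ₗ⁅k⁆ Derivation k (Shat k n) (Shat k n)) :
    (Env k g ⊗[k] Shat k n) →ₗ[k] Env k g →ₗ[k] Env k g :=
  LinearMap.mk₂ k (fun a u => fockProj (weylMul φ a (u ⊗ₜ[k] 1)))
    (fun a a' u => by simp) (fun c a u => by simp)
    (fun a u u' => by simp [TensorProduct.add_tmul])
    (fun c a u => by simp [← TensorProduct.smul_tmul'])

/-- The action `P ▸ u` of deformed derivatives on `U(g)`: the restriction of the deformed Fock
representation to `Ŝ(g*) ⊆ A_{g,φ}`. -/
noncomputable def derivAct (φ : g →ₗ⁅k⁆ Derivation k (Shat k n) (Shat k n)) :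
    Shat k n →ₗ[k] Env k g →ₗ[k] Env k g :=
  fockAct φ ∘ₗ TensorProduct.mk k (Env k g) (Shat k n) 1

/-- `∑ (T₍₁₎ · u)(T₍₂₎ · v)` for `T = ∑ T₍₁₎ ⊗ T₍₂₎` in the completed tensor square and an action of
`Ŝ(g*)` on `U(g)`. For a continuous action only finitely many terms of the sum are nonzero. -/
noncomputable def tensorAct (act : Shat k n →ₗ[k] Env k g →ₗ[k] Env k g) (T : Shat2 k n)
    (u v : Env k g) : Env k g :=
  ∑ᶠ p : (Fin n →₀ ℕ) × (Fin n →₀ ℕ),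
    coeff2 p.1 p.2 T • (act (dmon k p.1) u * act (dmon k p.2) v)

/-- `T` satisfies the deformed Leibniz rule for `P`:
`P ▸ (u v) = ∑ (T₍₁₎ ▸ u)(T₍₂₎ ▸ v)` for all `u, v` in `U(g)`. -/
def LeibnizRule (φ : g →ₗ⁅k⁆ Derivation k (Shat k n) (Shat k n)) (P : Shat k n) (T : Shat2 k n) :
    Prop :=
  ∀ u v : Env k g, derivAct φ P (u * v) = tensorAct (derivAct φ) T u v

/-- The `φ`-deformed coproduct `Ŝ(g*) → Ŝ(g*) ⊗̂ Ŝ(g*)`: the linear map defined by the deformed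
Leibniz rule. -/
noncomputable def deformedCoproduct (φ : g →ₗ⁅k⁆ Derivation k (Shat k n) (Shat k n)) :
    Shat k n →ₗ[k] Shat2 k n :=
  Classical.epsilon fun Δ => ∀ P, LeibnizRule φ P (Δ P)

/-! ### Topological Hopf algebras, actions and Hopf pairings -/

/-- `Δ` makes the algebra `Ŝ(g*)` into a topological Hopf algebra with counit the constant term.
The axioms are written out on coefficients: for instance the coefficient of `∂^a ⊗ ∂^b ⊗ ∂^c` in
`(Δ ⊗ id)(T)` is `∑_α T_{α c} Δ(∂^α)_{a b}`. Since `Δ` is multiplicative and counital, `Δ(∂^α)` has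
no terms of total degree less than `|α|`, so that these sums are finite. An antipode of the
commutative algebra `Ŝ(g*)` is an algebra map. -/
structure IsTopologicalHopfAlgebra (Δ : Shat k n →ₗ[k] Shat2 k n) : Prop where
  map_one : Δ 1 = 1
  map_mul : ∀ P Q, Δ (P * Q) = Δ P * Δ Q
  counit_left : ∀ P β, coeff2 0 β (Δ P) = MvPowerSeries.coeff β P
  counit_right : ∀ P α, coeff2 α 0 (Δ P) = MvPowerSeries.coeff α P
  coassoc : ∀ P a b c,
    ∑ᶠ α : Fin n →₀ ℕ, coeff2 α c (Δ P) * coeff2 a b (Δ (dmon k α)) =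
      ∑ᶠ α : Fin n →₀ ℕ, coeff2 a α (Δ P) * coeff2 b c (Δ (dmon k α))
  antipode : ∃ S : Shat k n →ₐ[k] Shat k n, ∀ P c,
    ∑ᶠ p : (Fin n →₀ ℕ) × (Fin n →₀ ℕ), coeff2 p.1 p.2 (Δ P) *
        MvPowerSeries.coeff c (S (dmon k p.1) * dmon k p.2) =
      MvPowerSeries.coeff c (algebraMap k (Shat k n) (vac k n P)) ∧
    ∑ᶠ p : (Fin n →₀ ℕ) × (Fin n →₀ ℕ), coeff2 p.1 p.2 (Δ P) *
        MvPowerSeries.coeff c (dmon k p.1 * S (dmon k p.2)) =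
      MvPowerSeries.coeff c (algebraMap k (Shat k n) (vac k n P))

/-- A Hopf pairing of `U(g)` with the topological Hopf algebra `(Ŝ(g*), Δ)`: it is continuous in the
second argument, and product and coproduct, unit and counit are dual to each other. -/
structure IsHopfPairing (Δ : Shat k n →ₗ[k] Shat2 k n) (pair : Env k g →ₗ[k] Shat k n →ₗ[k] k) :
    Prop where
  continuous : ∀ u, ∃ N : ℕ, ∀ P : Shat k n, N ≤ P.order → pair u P = 0
  pair_mul : ∀ u P Q, pair u (P * Q) =
    LinearMap.mul' k k (TensorProduct.map (pair.flip P) (pair.flip Q) (Coalgebra.comul u))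
  mul_pair : ∀ u v P, pair (u * v) P =
    ∑ᶠ p : (Fin n →₀ ℕ) × (Fin n →₀ ℕ),
      coeff2 p.1 p.2 (Δ P) * (pair u (dmon k p.1) * pair v (dmon k p.2))
  pair_one : ∀ u, pair u 1 = Coalgebra.counit u
  one_pair : ∀ P, pair 1 P = vac k n P

/-- A (continuous) Hopf action of the topological Hopf algebra `(Ŝ(g*), Δ)` on the algebra
`U(g)`. -/
structure IsHopfAction (Δ : Shat k n →ₗ[k] Shat2 k n)
    (act : Shat k n →ₗ[k] Env k g →ₗ[k] Env k g) : Prop where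
  continuous : ∀ u, ∃ N : ℕ, ∀ P : Shat k n, N ≤ P.order → act P u = 0
  one_act : ∀ u, act 1 u = u
  mul_act : ∀ P Q u, act (P * Q) u = act P (act Q u)
  act_one : ∀ P, act P 1 = vac k n P • 1
  act_mul : ∀ P u v, act P (u * v) = tensorAct act (Δ P) u v

/-! ### The Heisenberg double -/

/-- Each element of `U(g)` is killed by all but finitely many monomials `∂^α`. -/
def LocallyFinite (act : Shat k n →ₗ[k] Env k g →ₗ[k] Env k g) : Prop :=
  ∀ v, {α : Fin n →₀ ℕ | act (dmon k α) v ≠ 0}.Finite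

/-- `T, v ↦ ∑ (T₍₁₎ · v) ⊗ T₍₂₎ = ∑_α (∂^α · v) ⊗ T_α`, a finite sum for each `v`. -/
noncomputable def contract (act : Shat k n →ₗ[k] Env k g →ₗ[k] Env k g) (h : LocallyFinite act) :
    Shat2 k n →ₗ[k] Env k g →ₗ[k] Env k g ⊗[k] Shat k n :=
  have fin : ∀ (T : Shat2 k n) (v : Env k g),
      (Function.support fun α => act (dmon k α) v ⊗ₜ[k] slice α T).Finite := fun T v =>
    (h v).subset fun α hα h0 => hα (by simp [h0])
  LinearMap.mk₂ k (fun T v => ∑ᶠ α : Fin n →₀ ℕ, act (dmon k α) v ⊗ₜ[k] slice α T)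
    (fun T T' v => by
      simp only [map_add, TensorProduct.tmul_add]
      exact finsum_add_distrib (fin T v) (fin T' v))
    (fun c T v => by
      simp only [map_smul, TensorProduct.tmul_smul]
      exact (smul_finsum' c (fin T v)).symm)
    (fun T v v' => by
      simp only [map_add, TensorProduct.add_tmul]
      exact finsum_add_distrib (fin T v) (fin T v'))
    (fun c T v => by
      simp only [map_smul, ← TensorProduct.smul_tmul']
      exact (smul_finsum' c (fin T v)).symm)

/-- The exchange rule `P · v = ∑ (P₍₁₎ · v) ⊗ P₍₂₎` of the smash product `U(g) ♯ Ŝ(g*)` for an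
action of the topological Hopf algebra `(Ŝ(g*), Δ)` on `U(g)`; the smash product has the product
`(u ⊗ P)(v ⊗ Q) = ∑ u (P₍₁₎ · v) ⊗ P₍₂₎ Q`. -/
noncomputable def smashExchange (Δ : Shat k n →ₗ[k] Shat2 k n)
    (act : Shat k n →ₗ[k] Env k g →ₗ[k] Env k g) (h : LocallyFinite act) :
    Shat k n →ₗ[k] Env k g →ₗ[k] Env k g ⊗[k] Shat k n :=
  contract act h ∘ₗ Δ

/-- The action `P · u = ∑ ⟨u₍₂₎, P⟩ u₍₁₎` of `Ŝ(g*)` on `U(g)` given by a pairing. -/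
noncomputable def pairingAct (pair : Env k g →ₗ[k] Shat k n →ₗ[k] k) :
    Shat k n →ₗ[k] Env k g →ₗ[k] Env k g :=
  LinearMap.mk₂ k
    (fun P u => TensorProduct.rid k (Env k g)
      ((pair.flip P).lTensor (Env k g) (Coalgebra.comul u)))
    (fun P P' u => by simp [LinearMap.lTensor_add])
    (fun c P u => by simp [LinearMap.lTensor_smul])
    (fun P u u' => by simp)
    (fun c P u => by simp)

/-- The ideal generated by `∂^1, …, ∂^n`. -/
noncomputable def augIdeal (k : Type*) [Field k] (n : ℕ) : Ideal (Shat k n) :=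
  Ideal.span (Set.range fun i => (MvPowerSeries.X i : Shat k n))

theorem dmon_mem (α : Fin n →₀ ℕ) : dmon k α ∈ augIdeal k n ^ α.degree := by
  induction α using Finsupp.induction_linear with
  | zero => simp
  | add a b ha hb =>
    have : dmon k (a + b) = dmon k a * dmon k b := by
      simp [dmon, MvPowerSeries.monomial_mul_monomial]
    rw [this, map_add, pow_add]
    exact Ideal.mul_mem_mul ha hb
  | single i m =>
    have : dmon k (Finsupp.single i m) = (MvPowerSeries.X i : Shat k n) ^ m := by
      rw [dmon, MvPowerSeries.X_pow_eq]
    rw [this, Finsupp.degree_single]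
    have hX : (MvPowerSeries.X i : Shat k n) ∈ augIdeal k n :=
      Ideal.subset_span (Set.mem_range_self i)
    exact Ideal.pow_mem_pow hX m

theorem derivation_mem (D : Derivation k (Shat k n) (Shat k n)) (N : ℕ) :
    ∀ P ∈ augIdeal k n ^ (N + 1), D P ∈ augIdeal k n ^ N := by
  induction N with
  | zero => simp
  | succ N ih =>
    intro P hP
    rw [pow_succ'] at hP
    refine Submodule.mul_induction_on hP (fun a ha b hb => ?_) (fun a b ha hb => ?_)
    · rw [Derivation.leibniz, smul_eq_mul, smul_eq_mul]
      refine Ideal.add_mem _ ?_ (Ideal.mul_mem_right _ _ hb)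
      rw [pow_succ']
      exact Ideal.mul_mem_mul ha (ih b hb)
    · rw [map_add]; exact Ideal.add_mem _ ha hb

theorem phiEnd_mem (φ : g →ₗ⁅k⁆ Derivation k (Shat k n) (Shat k n)) (u : Env k g) :
    ∃ d : ℕ, ∀ N, ∀ P ∈ augIdeal k n ^ (N + d), phiEnd φ u P ∈ augIdeal k n ^ N := by
  let s : Subalgebra k (Env k g) :=
    { carrier := {u | ∃ d : ℕ, ∀ N, ∀ P ∈ augIdeal k n ^ (N + d),
        phiEnd φ u P ∈ augIdeal k n ^ N}
      mul_mem' := fun {a b} ha hb => by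
        obtain ⟨d, hd⟩ := ha
        obtain ⟨e, he⟩ := hb
        refine ⟨d + e, fun N P hP => ?_⟩
        rw [map_mul]
        exact hd N _ (he _ _ (by rwa [add_assoc]))
      add_mem' := fun {a b} ha hb => by
        obtain ⟨d, hd⟩ := ha
        obtain ⟨e, he⟩ := hb
        refine ⟨d + e, fun N P hP => ?_⟩
        rw [map_add]
        exact Ideal.add_mem _ (hd N _ (Ideal.pow_le_pow_right (by omega) hP))
          (he N _ (Ideal.pow_le_pow_right (by omega) hP))
      algebraMap_mem' := fun r => by
        refine ⟨0, fun N P hP => ?_⟩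
        rw [AlgHom.commutes]
        exact Submodule.smul_of_tower_mem _ r hP }
  refine HD.UEnv.mem_of_gens s (fun x => ?_) u
  refine ⟨1, fun N P hP => ?_⟩
  rw [phiEnd_inc]
  exact derivation_mem _ N P hP

theorem pairing_eq_zero (φ : g →ₗ⁅k⁆ Derivation k (Shat k n) (Shat k n)) (u : Env k g) :
    ∃ d : ℕ, ∀ P ∈ augIdeal k n ^ d, pairing φ u P = 0 := by
  obtain ⟨d, hd⟩ := phiEnd_mem φ (HopfAlgebra.antipode k u)
  refine ⟨1 + d, fun P hP => ?_⟩
  have h1 := hd 1 P hP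
  rw [pow_one] at h1
  have h2 : augIdeal k n ≤ RingHom.ker (MvPowerSeries.constantCoeff (σ := Fin n) (R := k)) := by
    rw [augIdeal, Ideal.span_le]
    rintro _ ⟨i, rfl⟩
    simp
  have h3 := h2 h1
  rw [RingHom.mem_ker, ← MvPowerSeries.coeff_zero_eq_constantCoeff_apply] at h3
  exact h3

/-- Only finitely many `∂^α` act nontrivially on a given element of `U(g)`. -/
theorem pairingAct_locallyFinite (φ : g →ₗ⁅k⁆ Derivation k (Shat k n) (Shat k n)) :
    LocallyFinite (pairingAct (pairing φ)) := by
  intro v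
  have key : ∀ t : Env k g ⊗[k] Env k g, ∃ d : ℕ, ∀ P ∈ augIdeal k n ^ d,
      ((pairing φ).flip P).lTensor (Env k g) t = 0 := by
    intro t
    induction t with
    | zero => exact ⟨0, by simp⟩
    | add a b ha hb =>
      obtain ⟨d, hd⟩ := ha
      obtain ⟨e, he⟩ := hb
      refine ⟨d + e, fun P hP => ?_⟩
      rw [map_add, hd P (Ideal.pow_le_pow_right (by omega) hP),
        he P (Ideal.pow_le_pow_right (by omega) hP), add_zero]
    | tmul a b =>
      obtain ⟨d, hd⟩ := pairing_eq_zero φ b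
      exact ⟨d, fun P hP => by simp [hd P hP]⟩
  obtain ⟨d, hd⟩ := key (Coalgebra.comul v)
  refine (Finsupp.finite_of_degree_le d).subset fun α hα => ?_
  by_contra hlt
  refine hα ?_
  have hle : d ≤ α.degree := le_of_lt (not_le.mp hlt)
  have := hd (dmon k α) (Ideal.pow_le_pow_right hle (dmon_mem α))
  simp [pairingAct, this]

/-- The exchange rule of the Heisenberg double of `U(g)` and `(Ŝ(g*), Δ)` with respect to the
pairing `⟨ , ⟩_φ`: the smash product for the action `P · u = ∑ ⟨u₍₂₎, P⟩_φ u₍₁₎`. -/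
noncomputable def heisenbergExchange (φ : g →ₗ⁅k⁆ Derivation k (Shat k n) (Shat k n))
    (Δ : Shat k n →ₗ[k] Shat2 k n) :
    Shat k n →ₗ[k] Env k g →ₗ[k] Env k g ⊗[k] Shat k n :=
  smashExchange Δ (pairingAct (pairing φ)) (pairingAct_locallyFinite φ)

/-- The product of the Heisenberg double:
`(u ⊗ P)(v ⊗ Q) = ∑ ⟨v₍₂₎, P₍₁₎⟩_φ u v₍₁₎ ⊗ P₍₂₎ Q`. -/
noncomputable def heisenbergMul (φ : g →ₗ⁅k⁆ Derivation k (Shat k n) (Shat k n))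
    (Δ : Shat k n →ₗ[k] Shat2 k n) :
    (Env k g ⊗[k] Shat k n) →ₗ[k] (Env k g ⊗[k] Shat k n) →ₗ[k] (Env k g ⊗[k] Shat k n) :=
  exchangeMul (heisenbergExchange φ Δ)

end HD
end

section
attribute [local instance 100] LieRing.ofAssociativeRing LieAlgebra.ofAssociativeAlgebra

namespace HD

variable {k : Type*} {g : Type*} [Field k] [LieRing g] [LieAlgebra k g] {n : ℕ}

section

/-! ### Powers of the augmentation ideal -/

/-! Everything rests on one fact: the pairing identifies Ŝ(g*) with the full linear dual of U(g).
Under u ↦ φ(S(u)) the generator x_i acts by the derivation φ(-x_i), which is ∂/∂(∂^i) plus a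
derivation that does not lower the order of a series. Hence a product of l generators pairs to 0
with every series of order > l, and with ∂^β, |β| = l, it pairs to β! if its letters form the
multiset β and to 0 otherwise. In characteristic 0 this is triangular with nonzero diagonal. Since
U(g) is spanned by one product of generators per multi-index (the easy half of PBW), there is a
basis e_α of U(g) with ⟨e_α, P⟩ = P_α (`exists_dual_basis`, `pairing_basis`). Linear independence,
the hard half of PBW, is a by-product.

The structure of Ŝ(g*) is then transposed from U(g). Applying the counit to the Leibniz rule at u =
e_α, v = e_β forces the coefficients of Δ(P) to be ⟨e_α e_β, P⟩, and the Hopf axioms become,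
coefficient by coefficient, those of U(g). The coefficient of ∂^β in φ(S(v))(P) is ⟨v e_β, P⟩;
expanding v in the basis e_α shows that the Weyl and Heisenberg exchange rules are equal
(`smashExchange_eq_weylExchange`), so the required isomorphisms are identity maps.

Associativity comes from a faithful representation. A formal series acts on U(g) by u ↦ ∑ a_α (∂^α ▸
u). As ∂^γ ▸ e_α is e_{α-γ} or 0, the series can be recovered recursively from its operator
(`completedAct_injective`). Products go to composites (`completedAct_completedMul`), and U(g) ⊗
Ŝ(g*) embeds in its completion. -/

theorem coeff_dmon_self (α : Fin n →₀ ℕ) : MvPowerSeries.coeff α (dmon k α) = 1 :=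
  MvPowerSeries.coeff_monomial_same α 1

theorem coeff_dmon [DecidableEq (Fin n →₀ ℕ)] (α β : Fin n →₀ ℕ) :
    MvPowerSeries.coeff α (dmon k β) = if α = β then 1 else 0 := by
  classical
  rw [dmon, MvPowerSeries.coeff_monomial]
  congr

theorem dmon_zero : dmon k (0 : Fin n →₀ ℕ) = 1 := rfl

theorem dmon_mul (α β : Fin n →₀ ℕ) : dmon k α * dmon k β = dmon k (α + β) := by
  simp [dmon, MvPowerSeries.monomial_mul_monomial]

theorem coeff_mul_dmon (α β : Fin n →₀ ℕ) (P : Shat k n) :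
    MvPowerSeries.coeff α (P * dmon k β) =
      if β ≤ α then MvPowerSeries.coeff (α - β) P else 0 := by
  rw [dmon, MvPowerSeries.coeff_mul_monomial]; simp

theorem coeff_eq_zero_of_mem_augIdeal_pow {N : ℕ} {P : Shat k n} (hP : P ∈ augIdeal k n ^ N)
    {α : Fin n →₀ ℕ} (hα : α.degree < N) : MvPowerSeries.coeff α P = 0 := by
  have key : ∀ N : ℕ, ∀ P ∈ augIdeal k n ^ N, (N : ℕ∞) ≤ P.order := by
    have h1 : ∀ P ∈ augIdeal k n, 1 ≤ P.order := by
      intro P hP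
      rw [MvPowerSeries.one_le_order_iff_constCoeff_eq_zero, ← RingHom.mem_ker]
      revert P
      change augIdeal k n ≤ _
      rw [augIdeal, Ideal.span_le]
      rintro _ ⟨i, rfl⟩
      simp
    intro N
    induction N with
    | zero => simp
    | succ N ih =>
      intro P hP
      rw [pow_succ'] at hP
      refine Submodule.mul_induction_on hP (fun a ha b hb => ?_) (fun a b ha hb => ?_)
      · refine le_trans ?_ (MvPowerSeries.le_order_mul (f := a) (g := b))
        push_cast
        rw [add_comm]
        exact add_le_add (h1 a ha) (ih b hb)
      · exact le_trans (le_min ha hb) MvPowerSeries.min_order_le_add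
  exact MvPowerSeries.coeff_of_lt_order (lt_of_lt_of_le (by exact_mod_cast hα) (key N P hP))

theorem exists_le_degree_eq {N : ℕ} {α : Fin n →₀ ℕ} (h : N ≤ α.degree) :
    ∃ β ≤ α, β.degree = N := by
  induction N with
  | zero => exact ⟨0, by simp, by simp⟩
  | succ N ih =>
    obtain ⟨β, hβ, hd⟩ := ih (by omega)
    obtain ⟨i, hi⟩ : ∃ i, β i < α i := by
      by_contra! hc
      have : α ≤ β := hc
      have := le_antisymm this hβ
      subst this
      omega
    refine ⟨β + Finsupp.single i 1, fun j => ?_, by simp [hd]⟩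
    by_cases hj : i = j
    · subst hj; simpa using hi
    · simpa [Finsupp.single_apply, hj] using hβ j

/-- Each monomial of degree at least N is assigned one divisor `f α` of degree exactly N, and the
terms of P are grouped by that divisor. There are finitely many monomials of degree N, so P lies in
the ideal power itself, not merely in a closure. Together with the preceding vanishing of
coefficients, the N-th power is exactly the set of series of order at least N. -/
theorem mem_augIdeal_pow_of_coeff {N : ℕ} {P : Shat k n}
    (hP : ∀ α : Fin n →₀ ℕ, α.degree < N → MvPowerSeries.coeff α P = 0) :
    P ∈ augIdeal k n ^ N := by
  classical
  have hex : ∀ α : Fin n →₀ ℕ, ∃ β, N ≤ α.degree → β ≤ α ∧ β.degree = N := by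
    intro α
    by_cases h : N ≤ α.degree
    · obtain ⟨β, hβ⟩ := exists_le_degree_eq h
      exact ⟨β, fun _ => hβ⟩
    · exact ⟨0, fun h' => absurd h' h⟩
  choose f hf using hex
  let s : Finset (Fin n →₀ ℕ) := (Finsupp.finite_of_degree_le N).toFinset
  let Q : (Fin n →₀ ℕ) → Shat k n := fun β γ =>
    if f (γ + β) = β then MvPowerSeries.coeff (γ + β) P else 0
  have hQ : ∀ β γ, MvPowerSeries.coeff γ (Q β) =
    if f (γ + β) = β then MvPowerSeries.coeff (γ + β) P else 0 := fun β γ => rfl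
  have e : P = ∑ β ∈ s with β.degree = N, Q β * dmon k β := by
    ext α
    rw [map_sum]
    simp only [coeff_mul_dmon, hQ]
    by_cases h : N ≤ α.degree
    · obtain ⟨h1, h2⟩ := hf α h
      rw [Finset.sum_eq_single (f α)]
      · rw [if_pos h1, tsub_add_cancel_of_le h1, if_pos rfl]
      · intro β _ hβ
        by_cases hle : β ≤ α
        · rw [if_pos hle, tsub_add_cancel_of_le hle, if_neg (Ne.symm hβ)]
        · rw [if_neg hle]
      · intro hn
        exact absurd (by simp [s, h2]) hn
    · rw [hP α (not_le.mp h)]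
      symm
      refine Finset.sum_eq_zero fun β hβ => ?_
      rw [if_neg]
      intro hle
      have := Finsupp.degree_mono hle
      rw [(Finset.mem_filter.mp hβ).2] at this
      exact h this
  rw [e]
  refine Ideal.sum_mem _ fun β hβ => Ideal.mul_mem_left _ _ ?_
  rw [← (Finset.mem_filter.mp hβ).2]
  exact dmon_mem β

/-- A derivation that maps the variables to the augmentation ideal preserves its powers. -/
theorem derivation_mem_of_X (D : Derivation k (Shat k n) (Shat k n))
    (hD : ∀ j, D (MvPowerSeries.X j) ∈ augIdeal k n) (N : ℕ) :
    ∀ P ∈ augIdeal k n ^ N, D P ∈ augIdeal k n ^ N := by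
  have h1 : ∀ P ∈ augIdeal k n, D P ∈ augIdeal k n := by
    intro P hP
    refine Submodule.span_induction ?_ ?_ ?_ ?_ hP
    · rintro _ ⟨j, rfl⟩; exact hD j
    · simp
    · intro a b _ _ ha hb; rw [map_add]; exact Ideal.add_mem _ ha hb
    · intro a b hb h
      rw [smul_eq_mul, Derivation.leibniz, smul_eq_mul, smul_eq_mul]
      exact Ideal.add_mem _ (Ideal.mul_mem_left _ _ h) (Ideal.mul_mem_right _ _ hb)
  induction N with
  | zero => simp
  | succ N ih =>
    intro P hP
    rw [pow_succ'] at hP ⊢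
    refine Submodule.mul_induction_on hP (fun a ha b hb => ?_) (fun a b ha hb => ?_)
    · rw [Derivation.leibniz, smul_eq_mul, smul_eq_mul]
      refine Ideal.add_mem _ (Ideal.mul_mem_mul ha (ih b hb)) ?_
      rw [mul_comm b]
      exact Ideal.mul_mem_mul (h1 a ha) hb
    · rw [map_add]; exact Ideal.add_mem _ ha hb

/-! ### The anti-action of `U(g)` on power series -/

/-- The anti-action `u ↦ φ(S(u))` of `U(g)` on `Ŝ(g*)`. -/
noncomputable def antiAct (φ : g →ₗ⁅k⁆ Derivation k (Shat k n) (Shat k n)) :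
    Env k g →ₗ[k] Module.End k (Shat k n) :=
  (phiEnd φ).toLinearMap ∘ₗ HopfAlgebra.antipode k

variable (φ : g →ₗ⁅k⁆ Derivation k (Shat k n) (Shat k n))

theorem pairing_apply (u : Env k g) (P : Shat k n) :
    pairing φ u P = vac k n (antiAct φ u P) := rfl

@[simp] theorem antiAct_one : antiAct φ 1 = 1 := by
  change phiEnd φ (HD.UEnv.antipodeLin k g 1) = 1
  rw [HD.UEnv.antipodeLin_one, map_one]

theorem antiAct_mul (u v : Env k g) : antiAct φ (u * v) = antiAct φ v * antiAct φ u := by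
  change phiEnd φ (HD.UEnv.antipodeLin k g (u * v)) = _
  rw [HD.UEnv.antipodeLin_mul, map_mul]; rfl

theorem antiAct_inc (x : g) (P : Shat k n) :
    antiAct φ (UniversalEnvelopingAlgebra.ι k x) P = φ (-x) P := by
  change phiEnd φ (HD.UEnv.antipodeLin k g _) P = _
  rw [HD.UEnv.antipodeLin_inc, map_neg, LinearMap.neg_apply, phiEnd_inc, map_neg]
  rfl

/-- The antipode reverses products, so the left factor acts on P first. Pairings with a word can
thus be computed by stripping letters from the left. -/
theorem pairing_mul_left (u v : Env k g) (P : Shat k n) :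
    pairing φ (u * v) P = pairing φ v (antiAct φ u P) := by
  rw [pairing_apply, antiAct_mul]; rfl

theorem pairing_one_left (P : Shat k n) : pairing φ 1 P = vac k n P := by
  rw [pairing_apply, antiAct_one]; rfl

/-- `Ŝ(g*)` is a module algebra for the anti-action. -/
theorem antiAct_apply_mul (u : Env k g) (P Q : Shat k n) :
    antiAct φ u (P * Q) = LinearMap.mul' k (Shat k n)
      (TensorProduct.map ((antiAct φ).flip P) ((antiAct φ).flip Q) (Coalgebra.comul u)) := by
  let s : Subalgebra k (Env k g) :=
    { carrier := {u | ∀ P Q, antiAct φ u (P * Q) = LinearMap.mul' k (Shat k n)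
        (TensorProduct.map ((antiAct φ).flip P) ((antiAct φ).flip Q) (Coalgebra.comul u))}
      mul_mem' := fun {a b} ha hb P Q => by
        simp only [Set.mem_ofPred_eq] at ha hb ⊢
        rw [← (Coalgebra.Repr.arbitrary k a).eq] at ha
        rw [← (Coalgebra.Repr.arbitrary k b).eq] at hb
        rw [antiAct_mul, Module.End.mul_apply, ha, Bialgebra.comul_mul,
          ← (Coalgebra.Repr.arbitrary k a).eq, ← (Coalgebra.Repr.arbitrary k b).eq]
        simp [Finset.sum_mul_sum, hb, antiAct_mul]
      add_mem' := fun {a b} ha hb P Q => by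
        simp only [Set.mem_ofPred_eq] at ha hb ⊢
        simp only [map_add, LinearMap.add_apply, ha, hb]
      algebraMap_mem' := fun r P Q => by
        simp [Algebra.algebraMap_eq_smul_one, Algebra.TensorProduct.one_def] }
  exact HD.UEnv.mem_of_gens s (fun x P Q => by
    rw [HD.UEnv.comul_inc, antiAct_inc, map_add, TensorProduct.map_tmul, TensorProduct.map_tmul,
      map_add, LinearMap.mul'_apply, LinearMap.mul'_apply]
    simp only [LinearMap.flip_apply, antiAct_inc, antiAct_one, Module.End.one_apply]
    rw [Derivation.leibniz, smul_eq_mul, smul_eq_mul, add_comm, mul_comm Q]) u P Q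

/-- The constant term is multiplicative, so the module algebra property descends to the pairing. -/
theorem pairing_mul_right (u : Env k g) (P Q : Shat k n) :
    pairing φ u (P * Q) = LinearMap.mul' k k
      (TensorProduct.map ((pairing φ).flip P) ((pairing φ).flip Q) (Coalgebra.comul u)) := by
  rw [pairing_apply, antiAct_apply_mul]
  generalize (Coalgebra.comul u : Env k g ⊗[k] Env k g) = w
  induction w with
  | zero => simp
  | add c d hc hd => simp only [map_add, hc, hd]
  | tmul a b =>
    simp only [TensorProduct.map_tmul, LinearMap.mul'_apply, LinearMap.flip_apply, pairing_apply,
      vac, MvPowerSeries.coeff_zero_eq_constantCoeff_apply, map_mul]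

end

section

/-! ### A basis of `U(g)` dual to the monomials -/

/-- The difference sends each variable into the augmentation ideal, hence preserves its powers: to
leading order D is the partial derivative. -/
theorem derivation_sub_pderiv_mem {D : Derivation k (Shat k n) (Shat k n)} {i : Fin n}
    (hD : ∀ j, MvPowerSeries.constantCoeff (D (MvPowerSeries.X j)) = if i = j then 1 else 0)
    {N : ℕ} {P : Shat k n} (hP : P ∈ augIdeal k n ^ N) :
    D P - MvPowerSeries.pderiv k i P ∈ augIdeal k n ^ N := by
  refine derivation_mem_of_X (D - MvPowerSeries.pderiv k i) (fun j => ?_) N P hP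
  rw [← pow_one (augIdeal k n)]
  refine mem_augIdeal_pow_of_coeff fun α hα => ?_
  have h0 : α = 0 := by
    rw [← Finsupp.degree_eq_zero_iff]; omega
  subst h0
  rw [MvPowerSeries.coeff_zero_eq_constantCoeff_apply, Derivation.sub_apply, map_sub, hD,
    MvPowerSeries.pderiv_X]
  by_cases h : i = j
  · subst h; simp
  · simp [h, Ne.symm h]

theorem pderiv_dmon (i : Fin n) (β : Fin n →₀ ℕ) :
    MvPowerSeries.pderiv k i (dmon k β) = (β i : k) • dmon k (β - Finsupp.single i 1) := by
  classical
  ext γ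
  rw [MvPowerSeries.coeff_pderiv, map_smul, coeff_dmon, coeff_dmon, smul_eq_mul]
  by_cases h : γ + Finsupp.single i 1 = β
  · subst h; simp
  · rw [if_neg h, zero_mul]
    by_cases h0 : β i = 0
    · simp [h0]
    · rw [if_neg, mul_zero]
      rintro rfl
      exact h (tsub_add_cancel_of_le (Finsupp.single_le_iff.mpr (Nat.one_le_iff_ne_zero.mpr h0)))

/-! ### The length filtration of U(g) and the spanning half of PBW -/

theorem card_toMultiset_eq_degree (α : Fin n →₀ ℕ) :
    (Finsupp.toMultiset α).card = α.degree := by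
  rw [Finsupp.card_toMultiset]; rfl

/-- The product in `U(g)` of the basis elements indexed by a list. -/
noncomputable def listProd (x : Module.Basis (Fin n) k g) (l : List (Fin n)) : Env k g :=
  (l.map fun i => UniversalEnvelopingAlgebra.ι k (x i)).prod

variable (x : Module.Basis (Fin n) k g)

theorem listProd_nil : listProd x [] = 1 := rfl

theorem listProd_cons (i : Fin n) (l : List (Fin n)) :
    listProd x (i :: l) = UniversalEnvelopingAlgebra.ι k (x i) * listProd x l := by
  rw [listProd, List.map_cons, List.prod_cons]; rfl

theorem listProd_append (l l' : List (Fin n)) :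
    listProd x (l ++ l') = listProd x l * listProd x l' := by
  simp [listProd]

/-- The span of the products of at most `N` basis elements of `g`. -/
noncomputable def envFiltration (N : ℕ) : Submodule k (Env k g) :=
  Submodule.span k (listProd x '' {l | l.length ≤ N})

theorem listProd_mem {l : List (Fin n)} {N : ℕ} (h : l.length ≤ N) :
    listProd x l ∈ envFiltration x N :=
  Submodule.subset_span ⟨l, h, rfl⟩

theorem envFiltration_mono {M N : ℕ} (h : M ≤ N) : envFiltration x M ≤ envFiltration x N :=
  Submodule.span_mono (Set.image_mono fun _ hl => le_trans hl h)

theorem mul_mem_envFiltration {M N : ℕ} {u v : Env k g} (hu : u ∈ envFiltration x M)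
    (hv : v ∈ envFiltration x N) : u * v ∈ envFiltration x (M + N) := by
  have : envFiltration x M * envFiltration x N ≤ envFiltration x (M + N) := by
    rw [envFiltration, envFiltration, Submodule.span_mul_span, Submodule.span_le]
    rintro _ ⟨_, ⟨l, hl, rfl⟩, _, ⟨l', hl', rfl⟩, rfl⟩
    change listProd x l * listProd x l' ∈ _
    rw [← listProd_append]
    simp only [Set.mem_ofPred_eq] at hl hl'
    exact listProd_mem x (by simp; omega)
  exact this (Submodule.mul_mem_mul hu hv)

theorem inc_mem_envFiltration (y : g) :
    UniversalEnvelopingAlgebra.ι k y ∈ envFiltration x 1 := by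
  rw [← x.sum_repr y, map_sum]
  refine Submodule.sum_mem _ fun i _ => ?_
  rw [map_smul]
  refine Submodule.smul_mem _ _ ?_
  have := listProd_mem x (l := [i]) (N := 1) (by simp)
  rwa [listProd_cons, listProd_nil, mul_one] at this

theorem exists_mem_envFiltration (u : Env k g) : ∃ N, u ∈ envFiltration x N := by
  let s : Subalgebra k (Env k g) :=
    { carrier := {u | ∃ N, u ∈ envFiltration x N}
      mul_mem' := fun {a b} ⟨M, hM⟩ ⟨N, hN⟩ => ⟨M + N, mul_mem_envFiltration x hM hN⟩
      add_mem' := fun {a b} ⟨M, hM⟩ ⟨N, hN⟩ => ⟨M + N, Submodule.add_mem _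
        (envFiltration_mono x (by omega) hM) (envFiltration_mono x (by omega) hN)⟩
      algebraMap_mem' := fun r => ⟨0, by
        rw [Algebra.algebraMap_eq_smul_one]
        exact Submodule.smul_mem _ _ (listProd_mem x (l := []) (by simp))⟩ }
  exact HD.UEnv.mem_of_gens s (fun y => ⟨1, inc_mem_envFiltration x y⟩) u

/-- Exchanging two adjacent letters costs their bracket, a single element of g, so the error is
shorter by one letter. -/
theorem listProd_sub_mem_of_perm {l l' : List (Fin n)} (h : l.Perm l') :
    ∀ N, l.length ≤ N + 1 → listProd x l - listProd x l' ∈ envFiltration x N := by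
  induction h with
  | nil => simp
  | @cons a l l' h ih =>
    intro N hN
    rw [List.length_cons] at hN
    rw [listProd_cons, listProd_cons, ← mul_sub]
    cases N with
    -- For N = 0 the word has one letter and nothing to permute; the induction hypothesis needs a
    -- bound of the form N + 1 on the tail.
    | zero =>
      have h1 : l = [] := List.eq_nil_of_length_eq_zero (by omega)
      subst h1
      have h2 : l' = [] := List.nil_perm.mp h
      subst h2
      simp
    | succ N =>
      rw [add_comm]
      exact mul_mem_envFiltration x (inc_mem_envFiltration x _) (ih N (by omega))
  | swap a b l =>
    intro N hN
    simp only [List.length_cons] at hN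
    simp only [listProd_cons, ← mul_assoc]
    rw [← sub_mul, ← HD.UEnv.inc_lie]
    exact envFiltration_mono x (by omega) (mul_mem_envFiltration x (inc_mem_envFiltration x _)
      (listProd_mem x (le_refl l.length)))
  | trans h1 h2 ih1 ih2 =>
    intro N hN
    rw [← sub_add_sub_cancel]
    exact Submodule.add_mem _ (ih1 N hN) (ih2 N (h1.length_eq ▸ hN))

/-- The product of basis elements with multi-index `α`, in some order. -/
noncomputable def multiProd (α : Fin n →₀ ℕ) : Env k g :=
  listProd x (Finsupp.toMultiset α).toList

/-- A word of length N + 1 can be put in the chosen order of its multiset of letters, modulo shorter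
words. -/
theorem envFiltration_succ_le (N : ℕ) : envFiltration x (N + 1) ≤
    envFiltration x N ⊔ Submodule.span k (multiProd x '' {α | α.degree = N + 1}) := by
  conv_lhs => rw [envFiltration]
  rw [Submodule.span_le]
  rintro _ ⟨l, hl, rfl⟩
  simp only [Set.mem_ofPred_eq] at hl
  by_cases h : l.length ≤ N
  · exact Submodule.mem_sup_left (listProd_mem x h)
  · have hp : l.Perm (Finsupp.toMultiset (Multiset.toFinsupp (l : Multiset (Fin n)))).toList := by
      rw [← Multiset.coe_eq_coe]; simp
    rw [← sub_add_cancel (listProd x l) (multiProd x (Multiset.toFinsupp (l : Multiset (Fin n))))]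
    refine Submodule.add_mem_sup (listProd_sub_mem_of_perm x hp N hl)
      (Submodule.subset_span ⟨_, ?_, rfl⟩)
    have : (Multiset.toFinsupp (l : Multiset (Fin n))).degree = l.length := by
      rw [← card_toMultiset_eq_degree]; simp
    simp only [Set.mem_ofPred_eq]
    omega

/-! ### Triangularity of the pairing and the dual basis -/

variable (φ : g →ₗ⁅k⁆ Derivation k (Shat k n) (Shat k n))

/-- Each letter acts by a derivation and lowers the order by at most one, so a series of order above
the length of the word still ends with zero constant term. -/
theorem pairing_listProd_eq_zero (l : List (Fin n)) :
    ∀ P ∈ augIdeal k n ^ (l.length + 1), pairing φ (listProd x l) P = 0 := by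
  induction l with
  | nil =>
    intro P hP
    rw [listProd_nil, pairing_one_left]
    exact coeff_eq_zero_of_mem_augIdeal_pow hP (by simp)
  | cons i l ih =>
    intro P hP
    rw [listProd_cons, pairing_mul_left, antiAct_inc]
    exact ih _ (derivation_mem _ _ P hP)

theorem pairing_envFiltration_eq_zero {N : ℕ} {u : Env k g} (hu : u ∈ envFiltration x N)
    {P : Shat k n} (hP : P ∈ augIdeal k n ^ (N + 1)) : pairing φ u P = 0 := by
  have : envFiltration x N ≤ LinearMap.ker ((pairing φ).flip P) := by
    rw [envFiltration, Submodule.span_le]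
    rintro _ ⟨l, hl, rfl⟩
    exact pairing_listProd_eq_zero x φ l P (Ideal.pow_le_pow_right (Nat.succ_le_succ hl) hP)
  exact this hu

variable {φ}
variable [CharZero k] (hφ : ∀ i j : Fin n,
  MvPowerSeries.constantCoeff (φ (-x i) (MvPowerSeries.X j)) = if i = j then 1 else 0)

include hφ in
-- In the critical degree only the leading parts ∂/∂(∂^i) contribute. Differentiating ∂^β along all
-- letters gives β! when the letters exhaust β and 0 otherwise; characteristic 0 keeps β! nonzero.
theorem pairing_listProd_dmon_ne_zero_iff (l : List (Fin n)) :
    ∀ β : Fin n →₀ ℕ, β.degree = l.length →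
      (pairing φ (listProd x l) (dmon k β) ≠ 0 ↔ Finsupp.toMultiset β = (l : Multiset (Fin n))) := by
  induction l with
  | nil =>
    intro β hβ
    rw [List.length_nil, Finsupp.degree_eq_zero_iff] at hβ
    subst hβ
    simp [listProd_nil, pairing_one_left, vac, coeff_dmon_self]
  | cons i l ih =>
    intro β hβ
    rw [List.length_cons] at hβ
    -- The correction φ(-x_i) - ∂/∂(∂^i) keeps ∂^β in the power `l.length + 1`, which the remaining
    -- `l.length` letters annihilate.
    have h1 : pairing φ (listProd x (i :: l)) (dmon k β) =
        β i * pairing φ (listProd x l) (dmon k (β - Finsupp.single i 1)) := by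
      rw [listProd_cons, pairing_mul_left, antiAct_inc,
        ← sub_add_cancel (φ (-x i) (dmon k β)) (MvPowerSeries.pderiv k i (dmon k β)), map_add,
        pairing_listProd_eq_zero x φ l, pderiv_dmon, map_smul, zero_add, smul_eq_mul]
      rw [← hβ]
      exact derivation_sub_pderiv_mem (hφ i) (dmon_mem β)
    rw [h1]
    by_cases h : β i = 0
    · have : i ∉ Finsupp.toMultiset β := by
        rw [Finsupp.mem_toMultiset, Finsupp.mem_support_iff, not_not]; exact h
      simp only [h, Nat.cast_zero, zero_mul, ne_eq, not_true_eq_false, false_iff]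
      intro hc
      rw [hc] at this
      simp at this
    · have hle : Finsupp.single i 1 ≤ β := by
        rw [Finsupp.single_le_iff]; omega
      obtain ⟨γ, rfl⟩ := exists_add_of_le hle
      have hγ : γ.degree = l.length := by
        rw [map_add, Finsupp.degree_single] at hβ; omega
      rw [add_tsub_cancel_left, mul_ne_zero_iff, ih γ hγ, and_iff_right (by exact_mod_cast h),
        map_add, Finsupp.toMultiset_single, one_smul, Multiset.singleton_add, ← Multiset.cons_coe,
        Multiset.cons_inj_right]

include hφ in
theorem pairing_multiProd_dmon_ne_zero_iff {α β : Fin n →₀ ℕ} (h : β.degree = α.degree) :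
    pairing φ (multiProd x α) (dmon k β) ≠ 0 ↔ β = α := by
  rw [multiProd, pairing_listProd_dmon_ne_zero_iff x hφ, Multiset.coe_toList]
  · exact ⟨fun h => by simpa using congrArg Multiset.toFinsupp h, fun h => h ▸ rfl⟩
  · rw [Multiset.length_toList, card_toMultiset_eq_degree]; exact h

include hφ in
-- Descent along the filtration: a monomial of top degree N + 1 kills the lower part and isolates
-- one coefficient of the top part, which must therefore vanish. What is left at the end is a
-- scalar, detected by ∂^0 = 1.
theorem eq_zero_of_pairing_dmon {u : Env k g} (h : ∀ β, pairing φ u (dmon k β) = 0) : u = 0 := by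
  obtain ⟨N, hN⟩ := exists_mem_envFiltration x u
  have h0 : u ∈ envFiltration x 0 := by
    induction N with
    | zero => exact hN
    | succ N ih =>
      refine ih ?_
      obtain ⟨w, hw, v, hv, rfl⟩ := Submodule.mem_sup.mp (envFiltration_succ_le x N hN)
      obtain ⟨a, ha, rfl⟩ := (Finsupp.mem_span_image_iff_linearCombination k).mp hv
      have : a = 0 := by
        by_contra hne
        obtain ⟨β, hβ⟩ := Finsupp.support_nonempty_iff.mpr hne
        have hd : β.degree = N + 1 := ha hβ
        have := h β
        rw [map_add, LinearMap.add_apply, pairing_envFiltration_eq_zero x φ hw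
          (hd ▸ dmon_mem β), zero_add, Finsupp.linearCombination_apply, Finsupp.sum, map_sum,
          LinearMap.sum_apply, Finset.sum_eq_single β] at this
        · rw [map_smul, LinearMap.smul_apply, smul_eq_mul, mul_eq_zero] at this
          rcases this with h1 | h1
          · exact Finsupp.mem_support_iff.mp hβ h1
          · exact (pairing_multiProd_dmon_ne_zero_iff x hφ rfl).mpr rfl h1
        · intro α hα hne
          have hα' : α.degree = N + 1 := ha hα
          rw [map_smul, LinearMap.smul_apply, smul_eq_mul]
          refine mul_eq_zero_of_right _ ?_
          by_contra h1
          exact hne ((pairing_multiProd_dmon_ne_zero_iff x hφ (hd.trans hα'.symm)).mp h1).symm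
        · intro hn; exact absurd hβ hn
      rw [this, map_zero, add_zero]
      exact hw
  have h1 : envFiltration x 0 ≤ Submodule.span k {1} := by
    rw [envFiltration, Submodule.span_le]
    rintro _ ⟨l, hl, rfl⟩
    have : l = [] := List.eq_nil_of_length_eq_zero (Nat.le_zero.mp hl)
    subst this
    exact Submodule.mem_span_singleton_self _
  obtain ⟨c, rfl⟩ := Submodule.mem_span_singleton.mp (h1 h0)
  have := h 0
  rw [map_smul, LinearMap.smul_apply, pairing_one_left, vac, coeff_dmon_self, smul_eq_mul,
    mul_one] at this
  rw [this, zero_smul]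

variable (φ) in
/-- The coordinates `⟨u, ∂^α⟩` of an element `u` of `U(g)`. -/
noncomputable def pairingCoord : Env k g →ₗ[k] (Fin n →₀ ℕ) →₀ k where
  toFun u := Finsupp.ofSupportFinite (fun α => pairing φ u (dmon k α)) (by
    obtain ⟨d, hd⟩ := pairing_eq_zero φ u
    refine (Finsupp.finite_of_degree_le d).subset fun α hα => ?_
    by_contra hlt
    exact hα (hd _ (Ideal.pow_le_pow_right (le_of_lt (not_le.mp hlt)) (dmon_mem α))))
  map_add' u v := by ext; simp [Finsupp.ofSupportFinite_coe]
  map_smul' c u := by ext; simp [Finsupp.ofSupportFinite_coe]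

include hφ in
-- Triangular inversion: the coordinates of `multiProd x α` are a nonzero entry at α plus entries of
-- strictly smaller degree, which are in the range by induction on the degree.
theorem pairingCoord_surjective : Function.Surjective (pairingCoord φ) := by
  classical
  have key : ∀ N, ∀ α : Fin n →₀ ℕ, α.degree < N →
      ∀ c : k, Finsupp.single α c ∈ LinearMap.range (pairingCoord φ) := by
    intro N
    induction N with
    | zero => intro α h; omega
    | succ N ih =>
      intro α hα
      set a := pairingCoord φ (multiProd x α) with ha
      have h0 : a α ≠ 0 := (pairing_multiProd_dmon_ne_zero_iff x hφ rfl).mpr rfl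
      have h1 : a.erase α ∈ LinearMap.range (pairingCoord φ) := by
        rw [← Finsupp.sum_single (a.erase α)]
        refine Submodule.sum_mem _ fun β hβ => ih β ?_ _
        rw [Finsupp.support_erase, Finset.mem_erase, Finsupp.mem_support_iff] at hβ
        have hle : β.degree ≤ α.degree := by
          by_contra hlt
          refine hβ.2 (pairing_listProd_eq_zero x φ _ _ ?_)
          rw [Multiset.length_toList, card_toMultiset_eq_degree]
          exact Ideal.pow_le_pow_right (not_le.mp hlt) (dmon_mem β)
        have hne : β.degree ≠ α.degree := fun h =>
          hβ.1 ((pairing_multiProd_dmon_ne_zero_iff x hφ h).mp hβ.2)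
        omega
      have h2 : Finsupp.single α (a α) ∈ LinearMap.range (pairingCoord φ) := by
        have : Finsupp.single α (a α) = a - a.erase α :=
          eq_sub_of_add_eq (Finsupp.single_add_erase α a)
        rw [this]
        exact Submodule.sub_mem _ (LinearMap.mem_range_self _ _) h1
      intro c
      have := Submodule.smul_mem _ (c * (a α)⁻¹) h2
      rwa [Finsupp.smul_single, smul_eq_mul, mul_assoc, inv_mul_cancel₀ h0, mul_one] at this
  rw [← LinearMap.range_eq_top, eq_top_iff]
  intro f _
  rw [← Finsupp.sum_single f]
  exact Submodule.sum_mem _ fun α _ => key _ α (Nat.lt_succ_self _) _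

include hφ in
/-- `U(g)` has a basis that is dual to the monomials under the pairing. -/
theorem exists_dual_basis : ∃ e : Module.Basis (Fin n →₀ ℕ) k (Env k g),
    ∀ u α, e.repr u α = pairing φ u (dmon k α) := by
  refine ⟨Module.Basis.ofRepr (LinearEquiv.ofBijective (pairingCoord φ)
    ⟨?_, pairingCoord_surjective x hφ⟩), fun u α => rfl⟩
  rw [injective_iff_map_eq_zero]
  intro u hu
  exact eq_zero_of_pairing_dmon x hφ fun β => DFunLike.congr_fun hu β

end

section

variable (φ : g →ₗ⁅k⁆ Derivation k (Shat k n) (Shat k n))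

/-! ### The action of `Ŝ(g*)` on `U(g)` -/

theorem pairing_one_right (u : Env k g) : pairing φ u 1 = Coalgebra.counit u := by
  have key : antiAct φ u 1 = (Coalgebra.counit u : k) • (1 : Shat k n) := by
    let s : Subalgebra k (Env k g) :=
      { carrier := {u | antiAct φ u 1 = (Coalgebra.counit u : k) • (1 : Shat k n)}
        mul_mem' := fun {a b} ha hb => by
          simp only [Set.mem_ofPred_eq] at ha hb ⊢
          rw [antiAct_mul, Module.End.mul_apply, ha, map_smul, hb, Bialgebra.counit_mul, smul_smul]
        add_mem' := fun {a b} ha hb => by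
          simp only [Set.mem_ofPred_eq] at ha hb ⊢
          rw [map_add, LinearMap.add_apply, ha, hb, map_add, add_smul]
        algebraMap_mem' := fun r => by
          simp [Algebra.algebraMap_eq_smul_one] }
    exact HD.UEnv.mem_of_gens s (fun x => by
      change _ = _
      rw [antiAct_inc, HD.UEnv.counit_inc, zero_smul, Derivation.map_one_eq_zero]) u
  rw [pairing_apply, key, map_smul, vac, ← dmon_zero, coeff_dmon_self, smul_eq_mul, mul_one]

/-- Projecting the exchange rule to U(g) replaces φ(S(u₍₂₎))(P) by its constant term, which is the
pairing of u₍₂₎ with P. -/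
theorem derivAct_eq : derivAct φ = pairingAct (pairing φ) := by
  refine LinearMap.ext fun P => LinearMap.ext fun u => ?_
  change fockProj (((1 : Env k g) ⊗ₜ[k] (1 : Shat k n)) * (weylExchange φ P u) *
    ((1 : Env k g) ⊗ₜ[k] (1 : Shat k n))) = _
  rw [← Algebra.TensorProduct.one_def, one_mul, mul_one]
  change (TensorProduct.rid k (Env k g)) ((vac k n).lTensor (Env k g)
    (LinearMap.lTensor (Env k g) _ (Coalgebra.comul u))) = _
  rw [← LinearMap.lTensor_comp_apply]
  rfl

variable {φ} in
theorem pairingAct_eq_sum (P : Shat k n) {u : Env k g} {κ : Type*} (r : Coalgebra.Repr k u κ) :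
    pairingAct (pairing φ) P u = ∑ i ∈ r.index, pairing φ (r.right i) P • r.left i := by
  change TensorProduct.rid k (Env k g)
      (((pairing φ).flip P).lTensor (Env k g) (Coalgebra.comul u)) = _
  rw [← r.eq]
  simp

variable {φ} in
theorem pairingAct_mul_eq_sum (P : Shat k n) {u v : Env k g} {κ κ' : Type*}
    (r : Coalgebra.Repr k u κ) (q : Coalgebra.Repr k v κ') :
    pairingAct (pairing φ) P (u * v) = ∑ i ∈ r.index, ∑ j ∈ q.index,
      pairing φ (r.right i * q.right j) P • (r.left i * q.left j) := by
  change TensorProduct.rid k (Env k g)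
    (((pairing φ).flip P).lTensor (Env k g) (Coalgebra.comul (u * v))) = _
  rw [Bialgebra.comul_mul, ← r.eq, ← q.eq, Finset.sum_mul_sum]
  simp

/-- The action of P is the transpose of multiplication by P. With nondegeneracy, identities of the
action reduce to identities of power series. -/
theorem pairing_pairingAct (P Q : Shat k n) (u : Env k g) :
    pairing φ (pairingAct (pairing φ) P u) Q = pairing φ u (Q * P) := by
  let r := Coalgebra.Repr.arbitrary k u
  rw [pairingAct_eq_sum P r, pairing_mul_right, ← r.eq]
  simp [mul_comm]

/-- The counit recovers the pairing from the action; this is what makes the deformed coproduct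
unique. -/
theorem counit_pairingAct (P : Shat k n) (u : Env k g) :
    Coalgebra.counit (pairingAct (pairing φ) P u) = pairing φ u P := by
  rw [← pairing_one_right φ, pairing_pairingAct, one_mul]

theorem pairing_continuous (u : Env k g) :
    ∃ N : ℕ, ∀ P : Shat k n, N ≤ P.order → pairing φ u P = 0 := by
  obtain ⟨d, hd⟩ := pairing_eq_zero φ u
  exact ⟨d, fun P hP => hd P (mem_augIdeal_pow_of_coeff fun α hα =>
    MvPowerSeries.coeff_of_lt_order (lt_of_lt_of_le (by exact_mod_cast hα) hP))⟩

variable {φ} {e : Module.Basis (Fin n →₀ ℕ) k (Env k g)}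
  (he : ∀ u α, e.repr u α = pairing φ u (dmon k α))

include he in
-- The hypothesis concerns monomials only. Continuity of the pairing extends it to every series by
-- truncation.
theorem pairing_basis (α : Fin n →₀ ℕ) (P : Shat k n) :
    pairing φ (e α) P = MvPowerSeries.coeff α P := by
  classical
  obtain ⟨d, hd⟩ := pairing_eq_zero φ (e α)
  -- The term d makes the tail pair to zero with `e α`; the term `α.degree` makes α itself belong to
  -- s.
  let s : Finset (Fin n →₀ ℕ) := (Finsupp.finite_of_degree_le (d + α.degree)).toFinset
  have hs : ∀ β, β ∈ s ↔ β.degree ≤ d + α.degree := fun β => by simp [s]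
  have h1 : P - ∑ β ∈ s, MvPowerSeries.coeff β P • dmon k β ∈ augIdeal k n ^ d := by
    refine mem_augIdeal_pow_of_coeff fun γ hγ => ?_
    rw [map_sub, map_sum, Finset.sum_eq_single γ]
    · rw [map_smul, coeff_dmon_self, smul_eq_mul, mul_one, sub_self]
    · intro β _ hβ
      rw [map_smul, coeff_dmon, if_neg (Ne.symm hβ), smul_zero]
    · intro h
      exact absurd ((hs γ).mpr (by omega)) h
  have h2 := hd _ h1
  rw [map_sub, sub_eq_zero, map_sum, Finset.sum_eq_single α] at h2
  · rw [h2, map_smul, ← he, e.repr_self, Finsupp.single_eq_same, smul_eq_mul, mul_one]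
  · intro β _ hβ
    rw [map_smul, ← he, e.repr_self, Finsupp.single_eq_of_ne hβ, smul_zero]
  · intro h
    exact absurd ((hs α).mpr (by omega)) h

include he in
theorem ext_of_pairing {u v : Env k g} (h : ∀ P, pairing φ u P = pairing φ v P) : u = v :=
  e.repr.injective (Finsupp.ext fun α => by rw [he, he, h])

include he in
theorem basis_zero : e 0 = 1 :=
  ext_of_pairing he fun P => by rw [pairing_basis he, pairing_one_left]; rfl

include he in
theorem counit_basis [DecidableEq (Fin n →₀ ℕ)] (α : Fin n →₀ ℕ) :
    (Coalgebra.counit (e α) : k) = if α = 0 then 1 else 0 := by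
  rw [← pairing_one_right φ, pairing_basis he, ← dmon_zero, coeff_dmon]

include he in
/-- Linear functionals on `U(g)` are expanded in the dual basis. -/
theorem apply_eq_sum {M : Type*} [AddCommGroup M] [Module k M] (f : Env k g →ₗ[k] M) (u : Env k g)
    {s : Finset (Fin n →₀ ℕ)} (hs : (e.repr u).support ⊆ s) :
    f u = ∑ α ∈ s, pairing φ u (dmon k α) • f (e α) := by
  conv_lhs => rw [← e.linearCombination_repr u, Finsupp.linearCombination_apply,
    Finsupp.sum_of_support_subset _ hs (fun a c => c • e a) (fun _ _ => zero_smul k _), map_sum]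
  exact Finset.sum_congr rfl fun α _ => by rw [map_smul, he]

include he in
theorem support_pairing_finite (u : Env k g) :
    {α | pairing φ u (dmon k α) ≠ 0}.Finite :=
  (e.repr u).support.finite_toSet.subset fun α hα => by
    simpa [he] using hα

include he in
theorem finsum_apply_basis (f : Env k g →ₗ[k] k) (u : Env k g) :
    ∑ᶠ α : Fin n →₀ ℕ, f (e α) * pairing φ u (dmon k α) = f u := by
  rw [apply_eq_sum he f u (le_refl _), finsum_eq_sum_of_support_subset (s := (e.repr u).support)]
  · simp [mul_comm]
  · intro α hα
    have := right_ne_zero_of_mul hα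
    simpa [he] using this

theorem exists_finset_repr {u : Env k g} {κ : Type*} (r : Coalgebra.Repr k u κ) :
    ∃ s : Finset (Fin n →₀ ℕ), ∀ i ∈ r.index, (e.repr (r.right i)).support ⊆ s := by
  classical
  exact ⟨r.index.biUnion fun i => (e.repr (r.right i)).support, fun i hi =>
    Finset.subset_biUnion_of_mem (fun i => (e.repr (r.right i)).support) hi⟩

include he in
theorem pairingAct_eq_sum_dmon {u : Env k g} {κ : Type*} (r : Coalgebra.Repr k u κ)
    {s : Finset (Fin n →₀ ℕ)} (hs : ∀ i ∈ r.index, (e.repr (r.right i)).support ⊆ s)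
    (P : Shat k n) : pairingAct (pairing φ) P u =
      ∑ α ∈ s, MvPowerSeries.coeff α P • pairingAct (pairing φ) (dmon k α) u := by
  simp only [pairingAct_eq_sum _ r, Finset.smul_sum]
  rw [Finset.sum_comm]
  refine Finset.sum_congr rfl fun i hi => ?_
  rw [← LinearMap.flip_apply, apply_eq_sum he ((pairing φ).flip P) _ (hs i hi), Finset.sum_smul]
  refine Finset.sum_congr rfl fun α _ => ?_
  rw [LinearMap.flip_apply, pairing_basis he, smul_smul, smul_eq_mul, mul_comm]

include he in
theorem pairingAct_dmon_eq_zero {u : Env k g} {κ : Type*} (r : Coalgebra.Repr k u κ)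
    {s : Finset (Fin n →₀ ℕ)} (hs : ∀ i ∈ r.index, (e.repr (r.right i)).support ⊆ s)
    {α : Fin n →₀ ℕ} (hα : α ∉ s) : pairingAct (pairing φ) (dmon k α) u = 0 := by
  classical
  rw [pairingAct_eq_sum_dmon he r hs]
  refine Finset.sum_eq_zero fun β hβ => ?_
  rw [coeff_dmon, if_neg, zero_smul]
  rintro rfl
  exact hα hβ

include he in
-- Transpose of multiplication by ∂^γ on coefficients.
theorem pairingAct_dmon_basis (γ α : Fin n →₀ ℕ) [Decidable (γ ≤ α)] :
    pairingAct (pairing φ) (dmon k γ) (e α) = if γ ≤ α then e (α - γ) else 0 := by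
  classical
  refine ext_of_pairing he fun P => ?_
  rw [pairing_pairingAct, pairing_basis he, coeff_mul_dmon]
  split_ifs <;> simp [pairing_basis he]

include he in
-- Dual to ∂^β ∂^γ = ∂^(β+γ): the e_α comultiply like divided powers.
theorem comul_basis (α : Fin n →₀ ℕ) :
    (Coalgebra.comul (e α) : Env k g ⊗[k] Env k g) =
      ∑ p ∈ Finset.HasAntidiagonal.antidiagonal α, e p.1 ⊗ₜ[k] e p.2 := by
  classical
  -- Coordinates in the product basis are pairings with pairs of monomials.
  have key : ∀ (t : Env k g ⊗[k] Env k g) (β γ), (e.tensorProduct e).repr t (β, γ) =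
      LinearMap.mul' k k (TensorProduct.map ((pairing φ).flip (dmon k β))
        ((pairing φ).flip (dmon k γ)) t) := by
    intro t β γ
    induction t with
    | zero => simp
    | add a b ha hb => simp only [map_add, Finsupp.add_apply, ha, hb]
    | tmul a b => simp [he, mul_comm]
  refine (e.tensorProduct e).repr.injective (Finsupp.ext fun ⟨β, γ⟩ => ?_)
  rw [key, ← pairing_mul_right, dmon_mul, pairing_basis he, coeff_dmon, map_sum,
    Finsupp.finsetSum_apply]
  simp only [← Module.Basis.tensorProduct_apply, Module.Basis.repr_self, Finsupp.single_apply]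
  rw [Finset.sum_ite_eq']
  simp [eq_comm]

/-! ### The deformed coproduct -/

theorem coeff2_ext {T T' : Shat2 k n} (h : ∀ α β, coeff2 α β T = coeff2 α β T') : T = T' := by
  ext d
  have := h (Finsupp.sumFinsuppEquivProdFinsupp d).1 (Finsupp.sumFinsuppEquivProdFinsupp d).2
  have hd : Finsupp.sumElim (Finsupp.sumFinsuppEquivProdFinsupp d).1
      (Finsupp.sumFinsuppEquivProdFinsupp d).2 = d :=
    Finsupp.sumFinsuppEquivProdFinsupp.symm_apply_apply d
  simpa only [coeff2, hd] using this

/-- The coproduct of `Ŝ(g*)` that is dual to the product of `U(g)`, in terms of a dual basis. -/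
noncomputable def dualCoproduct (φ : g →ₗ⁅k⁆ Derivation k (Shat k n) (Shat k n))
    (e : Module.Basis (Fin n →₀ ℕ) k (Env k g)) : Shat k n →ₗ[k] Shat2 k n :=
  LinearMap.pi fun d => pairing φ (e (Finsupp.sumFinsuppEquivProdFinsupp d).1 *
    e (Finsupp.sumFinsuppEquivProdFinsupp d).2)

theorem coeff2_dualCoproduct (α β : Fin n →₀ ℕ) (P : Shat k n) :
    coeff2 α β (dualCoproduct φ e P) = pairing φ (e α * e β) P := by
  have hd : Finsupp.sumFinsuppEquivProdFinsupp (Finsupp.sumElim α β) = (α, β) :=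
    Finsupp.sumFinsuppEquivProdFinsupp.apply_symm_apply (α, β)
  change pairing φ (e (Finsupp.sumFinsuppEquivProdFinsupp (Finsupp.sumElim α β)).1 *
    e (Finsupp.sumFinsuppEquivProdFinsupp (Finsupp.sumElim α β)).2) P = _
  rw [hd]

include he in
theorem pairing_mul_eq_sum {u v : Env k g} {s t : Finset (Fin n →₀ ℕ)}
    (hs : (e.repr u).support ⊆ s) (ht : (e.repr v).support ⊆ t) (P : Shat k n) :
    pairing φ (u * v) P = ∑ p ∈ s ×ˢ t, coeff2 p.1 p.2 (dualCoproduct φ e P) *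
      (pairing φ u (dmon k p.1) * pairing φ v (dmon k p.2)) := by
  have h1 := apply_eq_sum he ((pairing φ).flip P ∘ₗ LinearMap.mulRight k v) u hs
  simp only [LinearMap.comp_apply, LinearMap.mulRight_apply, LinearMap.flip_apply] at h1
  rw [h1, Finset.sum_product]
  refine Finset.sum_congr rfl fun α _ => ?_
  have h2 := apply_eq_sum he ((pairing φ).flip P ∘ₗ LinearMap.mulLeft k (e α)) v ht
  simp only [LinearMap.comp_apply, LinearMap.mulLeft_apply, LinearMap.flip_apply] at h2
  rw [h2, Finset.smul_sum]
  refine Finset.sum_congr rfl fun β _ => ?_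
  rw [coeff2_dualCoproduct, smul_eq_mul, smul_eq_mul]
  ring

include he in
theorem support_pairing_mul_finite (u v : Env k g) (T : Shat2 k n) :
    (Function.support fun p : (Fin n →₀ ℕ) × (Fin n →₀ ℕ) => coeff2 p.1 p.2 T *
      (pairing φ u (dmon k p.1) * pairing φ v (dmon k p.2))).Finite := by
  refine ((support_pairing_finite he u).prod (support_pairing_finite he v)).subset fun p hp => ?_
  have := right_ne_zero_of_mul hp
  exact ⟨left_ne_zero_of_mul this, right_ne_zero_of_mul this⟩

include he in
theorem pairing_mul_eq_finsum (u v : Env k g) (P : Shat k n) :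
    pairing φ (u * v) P = ∑ᶠ p : (Fin n →₀ ℕ) × (Fin n →₀ ℕ),
      coeff2 p.1 p.2 (dualCoproduct φ e P) *
        (pairing φ u (dmon k p.1) * pairing φ v (dmon k p.2)) := by
  rw [pairing_mul_eq_sum he (le_refl _) (le_refl _), finsum_eq_sum_of_support_subset]
  intro p hp
  have := right_ne_zero_of_mul hp
  have h1 := left_ne_zero_of_mul this
  have h2 := right_ne_zero_of_mul this
  simp [he, h1, h2]

theorem tensorAct_eq_sum {act : Shat k n →ₗ[k] Env k g →ₗ[k] Env k g} {u v : Env k g}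
    {s t : Finset (Fin n →₀ ℕ)} (hs : ∀ α ∉ s, act (dmon k α) u = 0)
    (ht : ∀ α ∉ t, act (dmon k α) v = 0) (T : Shat2 k n) :
    tensorAct act T u v = ∑ p ∈ s ×ˢ t,
      coeff2 p.1 p.2 T • (act (dmon k p.1) u * act (dmon k p.2) v) := by
  rw [tensorAct, finsum_eq_sum_of_support_subset]
  intro p hp
  rw [Finset.coe_product]
  constructor
  · by_contra h
    exact hp (by simp only [hs _ h, zero_mul, smul_zero])
  · by_contra h
    exact hp (by simp only [ht _ h, mul_zero, smul_zero])

include he in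
-- The coproduct of U(g) is multiplicative, so the claim reduces to expanding the pairing of u₍₂₎
-- v₍₂₎ with P in the coefficients of the dual coproduct.
theorem pairingAct_mul (P : Shat k n) (u v : Env k g) :
    pairingAct (pairing φ) P (u * v) =
      tensorAct (pairingAct (pairing φ)) (dualCoproduct φ e P) u v := by
  let r := Coalgebra.Repr.arbitrary k u
  let q := Coalgebra.Repr.arbitrary k v
  obtain ⟨s, hs⟩ := exists_finset_repr (e := e) r
  obtain ⟨t, ht⟩ := exists_finset_repr (e := e) q
  rw [tensorAct_eq_sum (s := s) (t := t) (fun α hα => pairingAct_dmon_eq_zero he r hs hα)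
    (fun α hα => pairingAct_dmon_eq_zero he q ht hα)]
  rw [pairingAct_mul_eq_sum P r q]
  simp only [pairingAct_eq_sum _ r, pairingAct_eq_sum _ q, Finset.sum_mul_sum, Finset.smul_sum]
  conv_rhs => rw [Finset.sum_comm]
  refine Finset.sum_congr rfl fun i hi => ?_
  conv_rhs => rw [Finset.sum_comm]
  refine Finset.sum_congr rfl fun j hj => ?_
  rw [pairing_mul_eq_sum he (hs i hi) (ht j hj), Finset.sum_smul]
  refine Finset.sum_congr rfl fun p _ => ?_
  rw [smul_mul_smul_comm, smul_smul]

include he in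
theorem leibnizRule_dualCoproduct (P : Shat k n) : LeibnizRule φ P (dualCoproduct φ e P) := by
  intro u v
  rw [derivAct_eq, pairingAct_mul he]

include he in
theorem eq_dualCoproduct_of_leibnizRule {P : Shat k n} {T : Shat2 k n} (h : LeibnizRule φ P T) :
    T = dualCoproduct φ e P := by
  classical
  refine coeff2_ext fun α β => ?_
  have hl : ∀ u, ∀ γ ∉ (pairingAct_locallyFinite φ u).toFinset,
      pairingAct (pairing φ) (dmon k γ) u = 0 := by
    intro u γ hγ
    simpa using hγ
  -- Under the counit the left side becomes ⟨e_α e_β, P⟩, and on the right only the term of T at (α,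
  -- β) survives.
  have h1 := congrArg (Coalgebra.counit (R := k)) (h (e α) (e β))
  rw [derivAct_eq, counit_pairingAct, tensorAct_eq_sum (hl _) (hl _), map_sum,
    Finset.sum_eq_single (α, β)] at h1
  · rw [coeff2_dualCoproduct, h1, map_smul, Bialgebra.counit_mul, counit_pairingAct,
      counit_pairingAct, pairing_basis he, pairing_basis he, coeff_dmon_self, coeff_dmon_self]
    simp
  · intro p _ hp
    rw [map_smul, Bialgebra.counit_mul, counit_pairingAct,
      counit_pairingAct, pairing_basis he, pairing_basis he, coeff_dmon, coeff_dmon]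
    by_cases h1 : α = p.1
    · rw [if_neg (fun h2 => hp (Prod.ext h1.symm (Eq.symm h2))), mul_zero, smul_zero]
    · rw [if_neg h1, zero_mul, smul_zero]
  · intro hn
    rw [Finset.mem_product, not_and_or] at hn
    rcases hn with hn | hn
    · simp only [hl _ _ hn, zero_mul, smul_zero, map_zero]
    · simp only [hl _ _ hn, mul_zero, smul_zero, map_zero]

include he in
-- The choice operator returns some linear solution because the dual coproduct is one; uniqueness
-- for each P then identifies the two.
theorem deformedCoproduct_eq : deformedCoproduct φ = dualCoproduct φ e := by
  have : ∀ P, LeibnizRule φ P (deformedCoproduct φ P) :=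
    Classical.epsilon_spec (p := fun Δ : Shat k n →ₗ[k] Shat2 k n => ∀ P, LeibnizRule φ P (Δ P))
      ⟨dualCoproduct φ e, leibnizRule_dualCoproduct he⟩
  exact LinearMap.ext fun P => eq_dualCoproduct_of_leibnizRule he (this P)

end

section

variable {φ : g →ₗ⁅k⁆ Derivation k (Shat k n) (Shat k n)}

/-! ### The topological Hopf algebra -/

/-- Both sides reverse products, so it suffices to check generators. This is dual to
multiplicativity of the antipode of Ŝ(g*). -/
theorem comul_antipodeLin (u : Env k g) :
    (Coalgebra.comul (HD.UEnv.antipodeLin k g u) : Env k g ⊗[k] Env k g) =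
      TensorProduct.map (HD.UEnv.antipodeLin k g) (HD.UEnv.antipodeLin k g)
        (TensorProduct.comm k _ _ (Coalgebra.comul u)) := by
  let s : Subalgebra k (Env k g) :=
    { carrier := {u | (Coalgebra.comul (HD.UEnv.antipodeLin k g u) : Env k g ⊗[k] Env k g) =
        TensorProduct.map (HD.UEnv.antipodeLin k g) (HD.UEnv.antipodeLin k g)
          (TensorProduct.comm k _ _ (Coalgebra.comul u))}
      mul_mem' := fun {a b} ha hb => by
        simp only [Set.mem_ofPred_eq] at ha hb ⊢
        rw [HD.UEnv.antipodeLin_mul, Bialgebra.comul_mul, ha, hb, Bialgebra.comul_mul,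
          ← (Coalgebra.Repr.arbitrary k a).eq, ← (Coalgebra.Repr.arbitrary k b).eq]
        simp only [map_sum, TensorProduct.comm_tmul, TensorProduct.map_tmul, Finset.sum_mul_sum,
          Algebra.TensorProduct.tmul_mul_tmul, HD.UEnv.antipodeLin_mul]
        rw [Finset.sum_comm]
      add_mem' := fun {a b} ha hb => by
        simp only [Set.mem_ofPred_eq] at ha hb ⊢
        simp only [map_add, ha, hb]
      algebraMap_mem' := fun r => by
        simp [Algebra.algebraMap_eq_smul_one, Algebra.TensorProduct.one_def,
          HD.UEnv.antipodeLin_one] }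
  exact HD.UEnv.mem_of_gens s (fun x => by
    change _ = _
    rw [HD.UEnv.antipodeLin_inc, map_neg, HD.UEnv.comul_inc, map_add, map_add,
      TensorProduct.comm_tmul, TensorProduct.comm_tmul, TensorProduct.map_tmul,
      TensorProduct.map_tmul, HD.UEnv.antipodeLin_inc, HD.UEnv.antipodeLin_one,
      TensorProduct.neg_tmul, TensorProduct.tmul_neg]
    abel) u

variable {e : Module.Basis (Fin n →₀ ℕ) k (Env k g)}
  (he : ∀ u α, e.repr u α = pairing φ u (dmon k α))

/-- The linear map on `Ŝ(g*)` that is dual to the antipode of `U(g)`, in terms of a dual basis. -/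
noncomputable def dualAntipodeLin (φ : g →ₗ⁅k⁆ Derivation k (Shat k n) (Shat k n))
    (e : Module.Basis (Fin n →₀ ℕ) k (Env k g)) : Shat k n →ₗ[k] Shat k n :=
  LinearMap.pi fun α => pairing φ (HD.UEnv.antipodeLin k g (e α))

theorem coeff_dualAntipodeLin (α : Fin n →₀ ℕ) (P : Shat k n) :
    MvPowerSeries.coeff α (dualAntipodeLin φ e P) =
      pairing φ (HD.UEnv.antipodeLin k g (e α)) P := rfl

include he in
theorem dualAntipodeLin_one : dualAntipodeLin φ e 1 = 1 := by
  ext α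
  rw [coeff_dualAntipodeLin, ← pairing_basis he, pairing_one_right, pairing_one_right]
  exact HopfAlgebra.counit_antipode (R := k) (e α)

include he in
theorem dualAntipodeLin_mul (P Q : Shat k n) :
    dualAntipodeLin φ e (P * Q) = dualAntipodeLin φ e P * dualAntipodeLin φ e Q := by
  classical
  ext α
  rw [MvPowerSeries.coeff_mul, coeff_dualAntipodeLin, pairing_mul_right, comul_antipodeLin,
    comul_basis he]
  simp only [coeff_dualAntipodeLin]
  simp only [map_sum, TensorProduct.comm_tmul, TensorProduct.map_tmul, LinearMap.mul'_apply,
    LinearMap.flip_apply]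
  -- The flip in the coproduct of S(e_α) is absorbed by the symmetry of the antidiagonal.
  exact Finsupp.sum_antidiagonal_swap α fun a b =>
    pairing φ (HD.UEnv.antipodeLin k g (e b)) P * pairing φ (HD.UEnv.antipodeLin k g (e a)) Q

theorem coeff2_one [DecidableEq (Fin n →₀ ℕ)] (α β : Fin n →₀ ℕ) :
    coeff2 α β (1 : Shat2 k n) = (if α = 0 then 1 else 0) * if β = 0 then 1 else 0 := by
  classical
  rw [coeff2, MvPowerSeries.coeff_one]
  have : Finsupp.sumElim α β = 0 ↔ α = 0 ∧ β = 0 := by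
    rw [← Prod.mk_eq_zero, ← Finsupp.sumFinsuppEquivProdFinsupp.symm.injective.eq_iff]
    have h0 : Finsupp.sumFinsuppEquivProdFinsupp.symm (0 : (Fin n →₀ ℕ) × (Fin n →₀ ℕ)) = 0 := by
      ext (i | i) <;> rfl
    rw [h0]; rfl
  simp only [this, ite_and]
  split_ifs <;> simp

theorem coeff2_mul (α β : Fin n →₀ ℕ) (S T : Shat2 k n) :
    coeff2 α β (S * T) = ∑ p ∈ Finset.HasAntidiagonal.antidiagonal α,
      ∑ q ∈ Finset.HasAntidiagonal.antidiagonal β, coeff2 p.1 q.1 S * coeff2 p.2 q.2 T := by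
  classical
  have hadd : ∀ a b c d : Fin n →₀ ℕ, Finsupp.sumElim (a + b) (c + d) =
      Finsupp.sumElim a c + Finsupp.sumElim b d := by
    intro a b c d
    ext (i | i) <;> simp
  rw [← Finset.sum_product', coeff2, MvPowerSeries.coeff_mul]
  symm
  refine Finset.sum_bij'
    (fun r _ => (Finsupp.sumElim r.1.1 r.2.1, Finsupp.sumElim r.1.2 r.2.2))
    (fun d _ => (((Finsupp.sumFinsuppEquivProdFinsupp d.1).1,
        (Finsupp.sumFinsuppEquivProdFinsupp d.2).1),
      ((Finsupp.sumFinsuppEquivProdFinsupp d.1).2,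
        (Finsupp.sumFinsuppEquivProdFinsupp d.2).2))) ?_ ?_ ?_ ?_ ?_
  · rintro ⟨⟨a, b⟩, c, d⟩ h
    simp only [Finset.mem_product, Finset.HasAntidiagonal.mem_antidiagonal] at h ⊢
    rw [← hadd, h.1, h.2]
  · rintro ⟨a, b⟩ h
    simp only [Finset.mem_product, Finset.HasAntidiagonal.mem_antidiagonal] at h ⊢
    constructor
    · ext i
      have := DFunLike.congr_fun h (Sum.inl i)
      simpa using this
    · ext i
      have := DFunLike.congr_fun h (Sum.inr i)
      simpa using this
  · rintro ⟨⟨a, b⟩, c, d⟩ h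
    ext <;> simp
  · rintro ⟨a, b⟩ h
    ext (i | i) <;> simp
  · rintro ⟨⟨a, b⟩, c, d⟩ h
    rfl

include he in
-- Each axiom is the transpose of one for U(g): unit and product come from multiplicativity of the
-- counit and coproduct, the counit laws from e_0 = 1, coassociativity from associativity, and the
-- antipode from S.
theorem isTopologicalHopfAlgebra_dualCoproduct :
    IsTopologicalHopfAlgebra (dualCoproduct φ e) where
  map_one := by
    classical
    refine coeff2_ext fun α β => ?_
    rw [coeff2_dualCoproduct, pairing_one_right, Bialgebra.counit_mul, counit_basis he,
      counit_basis he, coeff2_one]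
  map_mul P Q := by
    refine coeff2_ext fun α β => ?_
    rw [coeff2_dualCoproduct, coeff2_mul, pairing_mul_right, Bialgebra.comul_mul, comul_basis he,
      comul_basis he, Finset.sum_mul_sum]
    simp [coeff2_dualCoproduct]
  counit_left P β := by
    rw [coeff2_dualCoproduct, basis_zero he, one_mul, pairing_basis he]
  counit_right P α := by
    rw [coeff2_dualCoproduct, basis_zero he, mul_one, pairing_basis he]
  coassoc P a b c := by
    simp only [coeff2_dualCoproduct]
    -- The two sums expand e_a e_b and e_b e_c in the dual basis, so they are the pairings of P with
    -- the two bracketings of e_a e_b e_c.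
    have h1 := finsum_apply_basis he ((pairing φ).flip P ∘ₗ LinearMap.mulRight k (e c)) (e a * e b)
    have h2 := finsum_apply_basis he ((pairing φ).flip P ∘ₗ LinearMap.mulLeft k (e a)) (e b * e c)
    simp only [LinearMap.comp_apply, LinearMap.mulRight_apply, LinearMap.mulLeft_apply,
      LinearMap.flip_apply] at h1 h2
    rw [h1, h2, mul_assoc]
  antipode := by
    refine ⟨AlgHom.ofLinearMap (dualAntipodeLin φ e) (dualAntipodeLin_one he)
      (dualAntipodeLin_mul he), fun P c => ?_⟩
    have hunit : MvPowerSeries.coeff c (algebraMap k (Shat k n) (vac k n P)) =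
        pairing φ (algebraMap k (Env k g) (Coalgebra.counit (e c))) P := by
      rw [Algebra.algebraMap_eq_smul_one, Algebra.algebraMap_eq_smul_one, map_smul, map_smul,
        LinearMap.smul_apply, pairing_one_left, ← pairing_one_right φ, pairing_basis he,
        smul_eq_mul, smul_eq_mul, mul_comm]
    -- The convolution of f and h at e_c, paired with P, written in coefficients; taking one of the
    -- maps to be S and the other the identity gives the two antipode laws.
    have key : ∀ f h : Env k g →ₗ[k] Env k g,
        ∑ᶠ p : (Fin n →₀ ℕ) × (Fin n →₀ ℕ), coeff2 p.1 p.2 (dualCoproduct φ e P) *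
          ∑ q ∈ Finset.HasAntidiagonal.antidiagonal c,
            pairing φ (f (e q.1)) (dmon k p.1) * pairing φ (h (e q.2)) (dmon k p.2) =
        pairing φ (LinearMap.mul' k (Env k g) (TensorProduct.map f h (Coalgebra.comul (e c)))) P := by
      intro f h
      simp only [Finset.mul_sum]
      rw [finsum_sum_comm _ _ fun q _ => support_pairing_mul_finite he _ _ _]
      simp only [← pairing_mul_eq_finsum he]
      rw [comul_basis he]
      simp
    classical
    constructor
    · rw [hunit, ← HD.UEnv.antipode_left, LinearMap.rTensor, ← key]
      refine finsum_congr fun p => ?_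
      rw [MvPowerSeries.coeff_mul]
      simp only [AlgHom.ofLinearMap_apply, coeff_dualAntipodeLin, pairing_basis he,
        LinearMap.id_apply]
    · rw [hunit, ← HD.UEnv.antipode_right, LinearMap.lTensor, ← key]
      refine finsum_congr fun p => ?_
      rw [MvPowerSeries.coeff_mul]
      simp only [AlgHom.ofLinearMap_apply, coeff_dualAntipodeLin, pairing_basis he,
        LinearMap.id_apply]

include he in
theorem isHopfPairing_dualCoproduct : IsHopfPairing (dualCoproduct φ e) (pairing φ) where
  continuous := pairing_continuous φ
  pair_mul := pairing_mul_right φ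
  mul_pair := pairing_mul_eq_finsum he
  pair_one := pairing_one_right φ
  one_pair := pairing_one_left φ

include he in
theorem isHopfAction_dualCoproduct :
    IsHopfAction (dualCoproduct φ e) (pairingAct (pairing φ)) where
  continuous u := by
    let r := Coalgebra.Repr.arbitrary k u
    choose d hd using fun i => pairing_continuous φ (r.right i)
    -- The sum serves as a common bound for all the d i.
    refine ⟨∑ i ∈ r.index, d i, fun P hP => ?_⟩
    rw [pairingAct_eq_sum P r]
    refine Finset.sum_eq_zero fun i hi => ?_
    rw [hd i P (le_trans ?_ hP), zero_smul]
    exact_mod_cast Finset.single_le_sum (f := d) (fun _ _ => Nat.zero_le _) hi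
  one_act u := ext_of_pairing he fun R => by rw [pairing_pairingAct, mul_one]
  mul_act P Q u := ext_of_pairing he fun R => by
    rw [pairing_pairingAct, pairing_pairingAct, pairing_pairingAct, mul_assoc]
  act_one P := ext_of_pairing he fun R => by
    rw [pairing_pairingAct, map_smul, LinearMap.smul_apply, pairing_one_left, pairing_one_left,
      smul_eq_mul, mul_comm]
    simp only [vac, MvPowerSeries.coeff_zero_eq_constantCoeff_apply, map_mul]
  act_mul := pairingAct_mul he

/-! ### The two exchange rules agree -/

theorem weylExchange_eq_sum (P : Shat k n) {v : Env k g} {κ : Type*} (r : Coalgebra.Repr k v κ) :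
    weylExchange φ P v = ∑ i ∈ r.index, r.left i ⊗ₜ[k] antiAct φ (r.right i) P := by
  change LinearMap.lTensor (Env k g) _ (Coalgebra.comul v) = _
  rw [← r.eq]
  simp only [map_sum, LinearMap.lTensor_tmul]
  rfl

include he in
-- The two rules are compared coefficientwise in the second factor, where both give ⟨v₍₂₎ e_β, P⟩.
-- The action is a variable, so that the result applies both to the pairing action and to
-- `derivAct`, each with its own proof of local finiteness.
theorem smashExchange_eq_weylExchange {act : Shat k n →ₗ[k] Env k g →ₗ[k] Env k g}
    (h : LocallyFinite act) (hact : act = pairingAct (pairing φ)) :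
    smashExchange (dualCoproduct φ e) act h = weylExchange φ := by
  subst hact
  refine LinearMap.ext fun P => LinearMap.ext fun v => ?_
  let r := Coalgebra.Repr.arbitrary k v
  obtain ⟨s, hs⟩ := exists_finset_repr (e := e) r
  rw [weylExchange_eq_sum P r]
  change ∑ᶠ α : Fin n →₀ ℕ, pairingAct (pairing φ) (dmon k α) v ⊗ₜ[k]
    slice α (dualCoproduct φ e P) = _
  rw [finsum_eq_sum_of_support_subset (s := s)]
  · simp only [pairingAct_eq_sum _ r, TensorProduct.sum_tmul]
    rw [Finset.sum_comm]
    refine Finset.sum_congr rfl fun i hi => ?_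
    simp only [TensorProduct.smul_tmul, ← TensorProduct.tmul_sum]
    congr 1
    ext β
    rw [← pairing_basis he β (antiAct φ _ P), ← pairing_mul_left]
    have := apply_eq_sum he ((pairing φ).flip P ∘ₗ LinearMap.mulRight k (e β)) _ (hs i hi)
    simp only [LinearMap.comp_apply, LinearMap.mulRight_apply, LinearMap.flip_apply] at this
    rw [this, map_sum]
    refine Finset.sum_congr rfl fun α _ => ?_
    rw [map_smul, ← coeff2_dualCoproduct]
    rfl
  · intro α hα
    by_contra hn
    exact hα (by simp only [pairingAct_dmon_eq_zero he r hs hn, TensorProduct.zero_tmul])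

end

section

variable {φ : g →ₗ⁅k⁆ Derivation k (Shat k n) (Shat k n)}
variable {e : Module.Basis (Fin n →₀ ℕ) k (Env k g)}

/-! ### The completed algebra as an algebra of operators -/

theorem support_completedAct_finite (φ : g →ₗ⁅k⁆ Derivation k (Shat k n) (Shat k n))
    (a : Completed k g n) (u : Env k g) :
    (Function.support fun α => a α * pairingAct (pairing φ) (dmon k α) u).Finite :=
  (pairingAct_locallyFinite φ u).subset fun _ hα => right_ne_zero_of_mul hα

/-- The operator `u ↦ ∑_α a_α (∂^α ▸ u)` on `U(g)` defined by a formal series. -/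
noncomputable def completedAct (φ : g →ₗ⁅k⁆ Derivation k (Shat k n) (Shat k n))
    (a : Completed k g n) : Env k g →ₗ[k] Env k g where
  toFun u := ∑ᶠ α, a α * pairingAct (pairing φ) (dmon k α) u
  map_add' u v := by
    simp only [map_add, mul_add]
    exact finsum_add_distrib (support_completedAct_finite φ a u) (support_completedAct_finite φ a v)
  map_smul' c u := by
    simp only [map_smul, mul_smul_comm]
    exact (smul_finsum' c (support_completedAct_finite φ a u)).symm

theorem completedAct_apply (a : Completed k g n) (u : Env k g) :
    completedAct φ a u = ∑ᶠ α, a α * pairingAct (pairing φ) (dmon k α) u := rfl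

theorem completedAct_eq_sum (a : Completed k g n) {u : Env k g} {s : Finset (Fin n →₀ ℕ)}
    (hs : ∀ α ∉ s, pairingAct (pairing φ) (dmon k α) u = 0) :
    completedAct φ a u = ∑ α ∈ s, a α * pairingAct (pairing φ) (dmon k α) u := by
  rw [completedAct_apply, finsum_eq_sum_of_support_subset]
  intro α hα
  by_contra h
  exact hα (by simp only [hs _ h, mul_zero])

theorem completedAct_add (a b : Completed k g n) (u : Env k g) :
    completedAct φ (a + b) u = completedAct φ a u + completedAct φ b u := by
  simp only [completedAct_apply, Pi.add_apply, add_mul]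
  exact finsum_add_distrib (support_completedAct_finite φ a u) (support_completedAct_finite φ b u)

theorem exists_finset_pairingAct (φ : g →ₗ⁅k⁆ Derivation k (Shat k n) (Shat k n)) (u : Env k g) :
    ∃ s : Finset (Fin n →₀ ℕ), ∀ α ∉ s, pairingAct (pairing φ) (dmon k α) u = 0 :=
  ⟨(pairingAct_locallyFinite φ u).toFinset, fun α hα => by simpa using hα⟩

variable (he : ∀ u α, e.repr u α = pairing φ u (dmon k α))

include he in
-- The value at e_α is a_α plus terms a_γ e_{α-γ} with γ < α, so the coefficients are determined by
-- recursion on the degree.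
theorem completedAct_injective : Function.Injective (completedAct (g := g) φ) := by
  classical
  intro a b hab
  have key : ∀ N, ∀ α : Fin n →₀ ℕ, α.degree < N → a α = b α := by
    intro N
    induction N with
    | zero => intro α h; omega
    | succ N ih =>
      intro α hα
      have h1 : ∀ c : Completed k g n, completedAct φ c (e α) =
          c α + ∑ γ ∈ (Finset.Iic α).erase α, c γ * e (α - γ) := by
        intro c
        rw [completedAct_eq_sum (s := Finset.Iic α), ← Finset.add_sum_erase _ _ (by simp :
          α ∈ Finset.Iic α)]
        · simp only [pairingAct_dmon_basis he]
          congr 1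
          · simp [basis_zero he]
          · refine Finset.sum_congr rfl fun γ hγ => ?_
            rw [if_pos (Finset.mem_Iic.mp (Finset.mem_of_mem_erase hγ))]
        · intro γ hγ
          rw [pairingAct_dmon_basis he, if_neg (by simpa using hγ)]
      have h2 := DFunLike.congr_fun hab (e α)
      rw [h1, h1] at h2
      have h3 : ∑ γ ∈ (Finset.Iic α).erase α, a γ * e (α - γ) =
          ∑ γ ∈ (Finset.Iic α).erase α, b γ * e (α - γ) := by
        refine Finset.sum_congr rfl fun γ hγ => ?_
        rw [Finset.mem_erase, Finset.mem_Iic] at hγ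
        have hlt : γ.degree < α.degree := by
          obtain ⟨δ, rfl⟩ := exists_add_of_le hγ.2
          have : δ.degree ≠ 0 := by
            rw [ne_eq, Finsupp.degree_eq_zero_iff]
            rintro rfl
            exact hγ.1 (add_zero γ).symm
          rw [map_add]; omega
        rw [ih γ (by omega)]
      rw [h3] at h2
      exact add_right_cancel h2
  exact funext fun α => key _ α (Nat.lt_succ_self _)

/-- The operator on `U(g)` defined by an element of `U(g) ⊗ Ŝ(g*)`. -/
noncomputable def tensorOperator (φ : g →ₗ⁅k⁆ Derivation k (Shat k n) (Shat k n)) :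
    Env k g ⊗[k] Shat k n →ₗ[k] Module.End k (Env k g) :=
  TensorProduct.lift ((LinearMap.mul k (Module.End k (Env k g))).compl₁₂
    (LinearMap.mul k (Env k g)) (pairingAct (pairing φ)))

theorem tensorOperator_tmul (u w : Env k g) (P : Shat k n) :
    tensorOperator φ (u ⊗ₜ[k] P) w = u * pairingAct (pairing φ) P w := rfl

theorem toCompleted_tmul (u : Env k g) (P : Shat k n) (γ : Fin n →₀ ℕ) :
    toCompleted (u ⊗ₜ[k] P) γ = MvPowerSeries.coeff γ P • u := by
  simp [toCompleted]

include he in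
theorem completedAct_toCompleted (t : Env k g ⊗[k] Shat k n) :
    completedAct φ (toCompleted t) = tensorOperator φ t := by
  refine LinearMap.ext fun w => ?_
  induction t with
  | zero => simp [completedAct_apply]
  | add a b ha hb => rw [map_add, completedAct_add, ha, hb, map_add, LinearMap.add_apply]
  | tmul u P =>
    let r := Coalgebra.Repr.arbitrary k w
    obtain ⟨s, hs⟩ := exists_finset_repr (e := e) r
    rw [completedAct_eq_sum (s := s) _ fun α hα => pairingAct_dmon_eq_zero he r hs hα,
      tensorOperator_tmul, pairingAct_eq_sum_dmon he r hs, Finset.mul_sum]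
    refine Finset.sum_congr rfl fun α _ => ?_
    rw [toCompleted_tmul, smul_mul_assoc, mul_smul_comm]

theorem tensorOperator_mul_left (u : Env k g) (t : Env k g ⊗[k] Shat k n) (w : Env k g) :
    tensorOperator φ ((u ⊗ₜ[k] 1) * t) w = u * tensorOperator φ t w := by
  induction t with
  | zero => simp
  | add a b ha hb => rw [mul_add, map_add, LinearMap.add_apply, ha, hb, map_add,
      LinearMap.add_apply, mul_add]
  | tmul v Q =>
    rw [Algebra.TensorProduct.tmul_mul_tmul, one_mul, tensorOperator_tmul, tensorOperator_tmul,
      mul_assoc]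

include he in
theorem tensorOperator_mul_right (Q : Shat k n) (t : Env k g ⊗[k] Shat k n) (w : Env k g) :
    tensorOperator φ (t * (1 ⊗ₜ[k] Q)) w =
      tensorOperator φ t (pairingAct (pairing φ) Q w) := by
  induction t with
  | zero => simp
  | add a b ha hb => rw [add_mul, map_add, LinearMap.add_apply, ha, hb, map_add,
      LinearMap.add_apply]
  | tmul v P =>
    rw [Algebra.TensorProduct.tmul_mul_tmul, mul_one, tensorOperator_tmul, tensorOperator_tmul,
      (isHopfAction_dualCoproduct he).mul_act]

/-- The exchange rule is realised by operators: the product of P and v acts as left multiplication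
by v followed by the action of P. -/
theorem tensorOperator_weylExchange (P : Shat k n) (v w : Env k g) :
    tensorOperator φ (weylExchange φ P v) w = pairingAct (pairing φ) P (v * w) := by
  let r := Coalgebra.Repr.arbitrary k v
  let q := Coalgebra.Repr.arbitrary k w
  rw [weylExchange_eq_sum P r, map_sum, LinearMap.sum_apply]
  rw [pairingAct_mul_eq_sum P r q]
  refine Finset.sum_congr rfl fun i _ => ?_
  rw [tensorOperator_tmul, pairingAct_eq_sum _ q, Finset.mul_sum]
  refine Finset.sum_congr rfl fun j _ => ?_
  rw [pairing_mul_left, mul_smul_comm]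

include he in
theorem tensorOperator_weylMul (s t : Env k g ⊗[k] Shat k n) :
    tensorOperator φ (weylMul φ s t) = tensorOperator φ s * tensorOperator φ t := by
  induction s with
  | zero => simp
  | add a b ha hb => rw [map_add, LinearMap.add_apply, map_add, ha, hb, map_add, add_mul]
  | tmul u P =>
    induction t with
    | zero => simp
    | add a b ha hb => rw [map_add, map_add, ha, hb, map_add, mul_add]
    | tmul v Q =>
      refine LinearMap.ext fun w => ?_
      rw [weylMul, exchangeMul_tmul, tensorOperator_mul_right he, tensorOperator_mul_left,
        tensorOperator_weylExchange]
      rfl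

/-! ### The product of formal series as composition of operators -/

include he in
-- For β ≤ γ the coefficient at γ involves ⟨v₍₂₎ e_{γ-β}, ∂^α⟩, a coordinate of a fixed element of
-- U(g), hence nonzero for finitely many α only. For other β it vanishes.
theorem support_completedMul_finite (a b : Completed k g n) (γ : Fin n →₀ ℕ) :
    (Function.support fun p : (Fin n →₀ ℕ) × (Fin n →₀ ℕ) =>
      a p.1 * toCompleted (weylExchange φ (dmon k p.1) (b p.2) * (1 ⊗ₜ[k] dmon k p.2)) γ).Finite := by
  classical
  have h1 : ∀ (v : Env k g) (β : Fin n →₀ ℕ), ∃ s : Finset (Fin n →₀ ℕ), ∀ α ∉ s,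
      toCompleted (weylExchange φ (dmon k α) v * (1 ⊗ₜ[k] dmon k β)) γ = 0 := by
    intro v β
    let r := Coalgebra.Repr.arbitrary k v
    refine ⟨r.index.biUnion fun i => (e.repr (r.right i * e (γ - β))).support, fun α hα => ?_⟩
    rw [weylExchange_eq_sum _ r, Finset.sum_mul, map_sum, Finset.sum_apply]
    refine Finset.sum_eq_zero fun i hi => ?_
    rw [Algebra.TensorProduct.tmul_mul_tmul, toCompleted_tmul, coeff_mul_dmon,
      ← pairing_basis he, ← pairing_mul_left, ← he]
    have : e.repr (r.right i * e (γ - β)) α = 0 := by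
      by_contra hne
      exact hα (Finset.mem_biUnion.mpr ⟨i, hi, Finsupp.mem_support_iff.mpr hne⟩)
    rw [this, ite_self, zero_smul]
  have h2 : ∀ (v : Env k g) (α β : Fin n →₀ ℕ), ¬ β ≤ γ →
      toCompleted (weylExchange φ (dmon k α) v * (1 ⊗ₜ[k] dmon k β)) γ = 0 := by
    intro v α β hβ
    rw [weylExchange_eq_sum _ (Coalgebra.Repr.arbitrary k v), Finset.sum_mul, map_sum,
      Finset.sum_apply]
    refine Finset.sum_eq_zero fun i hi => ?_
    rw [Algebra.TensorProduct.tmul_mul_tmul, toCompleted_tmul, coeff_mul_dmon, if_neg hβ, zero_smul]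
  choose s hs using h1
  refine (((Finset.Iic γ).biUnion fun β => s (b β) β) ×ˢ Finset.Iic γ).finite_toSet.subset
    fun p hp => ?_
  have hp' := right_ne_zero_of_mul hp
  have hle : p.2 ≤ γ := by
    by_contra h
    exact hp' (h2 _ _ _ h)
  rw [Finset.mem_coe, Finset.mem_product, Finset.mem_biUnion]
  refine ⟨⟨p.2, Finset.mem_Iic.mpr hle, ?_⟩, Finset.mem_Iic.mpr hle⟩
  by_contra h
  exact hp' (hs _ _ _ h)

include he in
theorem completedAct_completedMul (a b : Completed k g n) :
    completedAct φ (completedMul (weylExchange φ) a b) = completedAct φ a * completedAct φ b := by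
  classical
  refine LinearMap.ext fun u => ?_
  obtain ⟨s, hs⟩ := exists_finset_pairingAct φ u
  choose t ht using fun β => exists_finset_pairingAct φ (b β * pairingAct (pairing φ) (dmon k β) u)
  -- Termwise form of the claim: the series of τ(∂^α, b_β) ∂^β acts as the composite of ∂^β, left
  -- multiplication by b_β, and ∂^α. The rest is interchange of finite sums.
  have hop : ∀ p : (Fin n →₀ ℕ) × (Fin n →₀ ℕ), ∑ γ ∈ s,
      toCompleted (weylExchange φ (dmon k p.1) (b p.2) * (1 ⊗ₜ[k] dmon k p.2)) γ *
        pairingAct (pairing φ) (dmon k γ) u =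
      pairingAct (pairing φ) (dmon k p.1) (b p.2 * pairingAct (pairing φ) (dmon k p.2) u) := by
    intro p
    rw [← completedAct_eq_sum _ hs, completedAct_toCompleted he, tensorOperator_mul_right he,
      tensorOperator_weylExchange]
  have hfin : ∀ γ ∈ s, (Function.support fun p : (Fin n →₀ ℕ) × (Fin n →₀ ℕ) =>
      a p.1 * toCompleted (weylExchange φ (dmon k p.1) (b p.2) * (1 ⊗ₜ[k] dmon k p.2)) γ *
        pairingAct (pairing φ) (dmon k γ) u).Finite := fun γ _ =>
    (support_completedMul_finite he a b γ).subset fun p hp => left_ne_zero_of_mul hp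
  rw [Module.End.mul_apply, completedAct_eq_sum _ hs, completedAct_eq_sum b hs, map_sum]
  have h1 : ∀ γ, completedMul (weylExchange φ) a b γ * pairingAct (pairing φ) (dmon k γ) u =
      ∑ᶠ p : (Fin n →₀ ℕ) × (Fin n →₀ ℕ),
      a p.1 * toCompleted (weylExchange φ (dmon k p.1) (b p.2) * (1 ⊗ₜ[k] dmon k p.2)) γ *
        pairingAct (pairing φ) (dmon k γ) u := fun γ =>
    finsum_mul' _ _ (support_completedMul_finite he a b γ)
  simp only [h1]
  rw [← finsum_sum_comm _ _ hfin]
  simp only [mul_assoc, ← Finset.mul_sum, hop]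
  rw [finsum_eq_sum_of_support_subset (s := (s.biUnion t) ×ˢ s), Finset.sum_product_right]
  · refine Finset.sum_congr rfl fun β hβ => ?_
    rw [completedAct_eq_sum]
    intro α hα
    refine ht β α fun h => hα (Finset.mem_biUnion.mpr ⟨β, hβ, h⟩)
  · intro p hp
    have hp' := right_ne_zero_of_mul hp
    have h2 : p.2 ∈ s := by
      by_contra h
      exact hp' (by rw [hs _ h, mul_zero, map_zero])
    rw [Finset.mem_coe, Finset.mem_product, Finset.mem_biUnion]
    refine ⟨⟨p.2, h2, ?_⟩, h2⟩
    by_contra h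
    exact hp' (ht _ _ h)

include he in
theorem toCompleted_weylMul (s t : Env k g ⊗[k] Shat k n) :
    toCompleted (weylMul φ s t) =
      completedMul (weylExchange φ) (toCompleted s) (toCompleted t) := by
  refine completedAct_injective he ?_
  rw [completedAct_completedMul he, completedAct_toCompleted he, completedAct_toCompleted he,
    completedAct_toCompleted he, tensorOperator_weylMul he]

/-- In the basis of U(g) a tensor is a finite family of power series, whose coefficients can be read
off its image. This brings associativity back from operators to the uncompleted tensor product. -/
theorem toCompleted_injective (e : Module.Basis (Fin n →₀ ℕ) k (Env k g)) :
    Function.Injective (toCompleted (k := k) (g := g) (n := n)) := by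
  rw [injective_iff_map_eq_zero]
  intro t ht
  refine (TensorProduct.equivFinsuppOfBasisLeft e).map_eq_zero_iff.mp (Finsupp.ext fun α => ?_)
  have key : ∀ t : Env k g ⊗[k] Shat k n, ∀ γ, MvPowerSeries.coeff γ
      (TensorProduct.equivFinsuppOfBasisLeft e t α) = e.repr (toCompleted t γ) α := by
    intro t γ
    induction t with
    | zero => simp
    | add a b ha hb => simp only [map_add, Finsupp.add_apply, Pi.add_apply, ha, hb]
    | tmul u P =>
      rw [toCompleted_tmul, TensorProduct.equivFinsuppOfBasisLeft_apply_tmul_apply]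
      simp [mul_comm]
  ext γ
  rw [key, ht]
  simp

include he in
theorem tensorOperator_one : tensorOperator φ (1 ⊗ₜ[k] 1) = 1 :=
  LinearMap.ext fun w => by
    rw [tensorOperator_tmul, one_mul, (isHopfAction_dualCoproduct he).one_act]; rfl

include he in
-- Composition of operators is associative and unital, and the representation is faithful.
theorem isUnitalAssociative_completedMul :
    IsUnitalAssociative (completedMul (weylExchange φ)) (toCompleted (1 ⊗ₜ[k] 1)) := by
  refine ⟨fun a b c => ?_, fun a => ?_, fun a => ?_⟩ <;> refine completedAct_injective he ?_
  · simp only [completedAct_completedMul he, mul_assoc]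
  · rw [completedAct_completedMul he, completedAct_toCompleted he, tensorOperator_one he, one_mul]
  · rw [completedAct_completedMul he, completedAct_toCompleted he, tensorOperator_one he, mul_one]

include he in
theorem isUnitalAssociative_weylMul :
    IsUnitalAssociative (fun a b => weylMul φ a b) (1 ⊗ₜ[k] 1) := by
  have hinj : Function.Injective (tensorOperator φ) := fun s t hst =>
    toCompleted_injective e (completedAct_injective he (by
      rw [completedAct_toCompleted he, completedAct_toCompleted he, hst]))
  refine ⟨fun a b c => ?_, fun a => ?_, fun a => ?_⟩ <;> refine hinj ?_
  · simp only [tensorOperator_weylMul he, mul_assoc]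
  · rw [tensorOperator_weylMul he, tensorOperator_one he, one_mul]
  · rw [tensorOperator_weylMul he, tensorOperator_one he, mul_one]

end

end HD
end

/-! ### The main theorem -/

theorem mainTheorem1 {k : Type*} {g : Type*} [Field k] [CharZero k] [LieRing g] [LieAlgebra k g]
    {n : ℕ} (x : Module.Basis (Fin n) k g)
    (φ : g →ₗ⁅k⁆ Derivation k (HD.Shat k n) (HD.Shat k n))
    (hφ : ∀ i j : Fin n,
      MvPowerSeries.constantCoeff (φ (-x i) (MvPowerSeries.X j)) = if i = j then 1 else 0) :
    -- the twisted Weyl algebra is an algebra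
    HD.IsUnitalAssociative (fun a b => HD.weylMul φ a b) (1 ⊗ₜ[k] 1) ∧
    -- the deformed Leibniz rule has exactly one solution, the deformed coproduct
    (∀ (P : HD.Shat k n) (T : HD.Shat2 k n),
      HD.LeibnizRule φ P T ↔ T = HD.deformedCoproduct φ P) ∧
    -- it yields a topological Hopf algebra, in Hopf pairing with `U(g)`
    HD.IsTopologicalHopfAlgebra (HD.deformedCoproduct φ) ∧
    HD.IsHopfPairing (HD.deformedCoproduct φ) (HD.pairing φ) ∧
    HD.IsHopfAction (HD.deformedCoproduct φ) (HD.pairingAct (HD.pairing φ)) ∧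
    -- the Heisenberg double is an algebra
    HD.IsUnitalAssociative (fun a b => HD.heisenbergMul φ (HD.deformedCoproduct φ) a b)
      (1 ⊗ₜ[k] 1) ∧
    -- it is isomorphic to the twisted Weyl algebra, compatibly with both subalgebras
    (∃ F : (HD.Env k g ⊗[k] HD.Shat k n) ≃ₗ[k] (HD.Env k g ⊗[k] HD.Shat k n),
      (∀ a b, F (HD.weylMul φ a b) =
        HD.heisenbergMul φ (HD.deformedCoproduct φ) (F a) (F b)) ∧
      (∀ u : HD.Env k g, F (u ⊗ₜ[k] 1) = u ⊗ₜ[k] 1) ∧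
      (∀ P : HD.Shat k n, F (1 ⊗ₜ[k] P) = 1 ⊗ₜ[k] P) ∧
      -- both products and the isomorphism extend to the completions
      (∀ s t, HD.toCompleted (HD.weylMul φ s t) =
        HD.completedMul (HD.weylExchange φ) (HD.toCompleted s) (HD.toCompleted t)) ∧
      (∀ s t, HD.toCompleted (HD.heisenbergMul φ (HD.deformedCoproduct φ) s t) =
        HD.completedMul (HD.heisenbergExchange φ (HD.deformedCoproduct φ))
          (HD.toCompleted s) (HD.toCompleted t)) ∧
      HD.IsUnitalAssociative (HD.completedMul (HD.weylExchange φ))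
        (HD.toCompleted (1 ⊗ₜ[k] 1)) ∧
      HD.IsUnitalAssociative
        (HD.completedMul (HD.heisenbergExchange φ (HD.deformedCoproduct φ)))
        (HD.toCompleted (1 ⊗ₜ[k] 1)) ∧
      ∃ G : HD.Completed k g n ≃ₗ[k] HD.Completed k g n,
        (∀ a b, G (HD.completedMul (HD.weylExchange φ) a b) =
          HD.completedMul (HD.heisenbergExchange φ (HD.deformedCoproduct φ)) (G a) (G b)) ∧
        ∀ t, G (HD.toCompleted t) = HD.toCompleted (F t)) ∧
    -- the action of deformed derivatives makes `A_{g,φ}` a smash product in the second way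
    (∃ h : HD.LocallyFinite (HD.derivAct φ), ∀ a b, HD.weylMul φ a b =
      HD.exchangeMul (HD.smashExchange (HD.deformedCoproduct φ) (HD.derivAct φ) h) a b) ∧
    -- and it satisfies, and is determined by, the formula `P ▸ u = ∑ ⟨u₍₂₎, P⟩_φ u₍₁₎`
    (∀ act : HD.Shat k n →ₗ[k] HD.Env k g →ₗ[k] HD.Env k g,
      act = HD.derivAct φ ↔
        ∀ (P : HD.Shat k n) (u : HD.Env k g), act P u =
          TensorProduct.rid k (HD.Env k g)
            (((HD.pairing φ).flip P).lTensor (HD.Env k g) (Coalgebra.comul u))) := by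
  obtain ⟨e, he⟩ := HD.exists_dual_basis x hφ
  have hΔ : HD.deformedCoproduct φ = HD.dualCoproduct φ e := HD.deformedCoproduct_eq he
  have hX : HD.heisenbergExchange φ (HD.deformedCoproduct φ) = HD.weylExchange φ := by
    rw [hΔ]
    exact HD.smashExchange_eq_weylExchange he _ rfl
  have hM : HD.heisenbergMul φ (HD.deformedCoproduct φ) = HD.weylMul φ := by
    rw [HD.heisenbergMul, hX, HD.weylMul]
  have hlf : HD.LocallyFinite (HD.derivAct φ) := by
    rw [HD.derivAct_eq]
    exact HD.pairingAct_locallyFinite φ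
  -- The Heisenberg and Weyl products are now the same maps, so the identity serves as the
  -- isomorphism both before and after completion.
  rw [hM, hX]
  refine ⟨HD.isUnitalAssociative_weylMul he, fun P T => ⟨fun h => ?_, ?_⟩, ?_, ?_, ?_,
    HD.isUnitalAssociative_weylMul he, ⟨LinearEquiv.refl k _, fun _ _ => rfl, fun _ => rfl,
      fun _ => rfl, HD.toCompleted_weylMul he, HD.toCompleted_weylMul he,
      HD.isUnitalAssociative_completedMul he, HD.isUnitalAssociative_completedMul he,
      LinearEquiv.refl k _, fun _ _ => rfl, fun _ => rfl⟩, ⟨hlf, fun a b => ?_⟩,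
    fun act => ⟨?_, fun h => ?_⟩⟩
  · rw [hΔ]
    exact HD.eq_dualCoproduct_of_leibnizRule he h
  · rintro rfl
    rw [hΔ]
    exact HD.leibnizRule_dualCoproduct he P
  · rw [hΔ]
    exact HD.isTopologicalHopfAlgebra_dualCoproduct he
  · rw [hΔ]
    exact HD.isHopfPairing_dualCoproduct he
  · rw [hΔ]
    exact HD.isHopfAction_dualCoproduct he
  · rw [HD.weylMul, hΔ, HD.smashExchange_eq_weylExchange he hlf (HD.derivAct_eq φ)]
  · rintro rfl P u
    rw [HD.derivAct_eq]
    rfl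
  · rw [HD.derivAct_eq]
    exact LinearMap.ext fun P => LinearMap.ext fun u => h P u
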